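/- Let $d\ge 1$, $1\le p<\infty$, $\alpha\ge 0$, and let $w\in A_p$ on $\mathbb{R}^d$; that is, $w$ is positive and locally integrable with $\sup_Q \langle w\rangle_Q\langle w^{-1/(p-1)}\rangle_Q^{p-1}<\infty$ if $p>1$, and $\sup_Q \langle w\rangle_Q\|w^{-1}\|_{L^\infty(Q)}<\infty$ if $p=1$. Here $Q$ ranges over all axis-parallel cubes in $\mathbb{R}^d$, $\ell(Q)$ is the side length of $Q$, $\langle f\rangle_Q=|Q|^{-1}\int_Q f$, and $w(Q)=\int_Q w$. For $1\le r<\infty$ and $f\in L^1_{\mathrm{loc}}(\mathbb{R}^d;\mathbb{C})$ put $$\mathcal{O}_w^{r,\alpha}(f;Q)=w(Q)^{-\alpha/d}\Big(\frac1{w(Q)}\int_Q\Big(\frac{|f-\langle f\rangle_Q|}{w}\Big)^r w\,dx\Big)^{1/r}\in[0,\infty].$$ Let $\mathrm{BMO}_w^{r,\alpha}$ be the set of all $f\in L^1_{\mathrm{loc}}(\mathbb{R}^d;\mathbb{C})$ with $\sup_Q\mathcal{O}_w^{r,\alpha}(f;Q)<\infty$, and let $\mathrm{VMO}_w^{r,\alpha}$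 be the set of all $f\in\mathrm{BMO}_w^{r,\alpha}$ such that $$\lim_{t\to0}\ \sup_{\ell(Q)\le t}\mathcal{O}_w^{r,\alpha}(f;Q)=0,\qquad \lim_{t\to\infty}\ \sup_{\ell(Q)\ge t}\mathcal{O}_w^{r,\alpha}(f;Q)=0,$$ and $\lim_{|x|\to\infty}\mathcal{O}_w^{r,\alpha}(f;Q+x)=0$ for every cube $Q$. Let $p'=p/(p-1)$ if $p>1$ and $p'=\infty$ if $p=1$. Then, for all $r$ with $1\le r\le p'$ and $r<\infty$, $$\mathrm{VMO}_w^{r,\alpha}=\mathrm{VMO}_w^{1,\alpha}.$$ -/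

import Mathlib

open MeasureTheory Filter Topology
open scoped ENNReal

namespace FracVMO

noncomputable section

/-- The axis-parallel cube `[a₁, a₁ + ℓ) × ⋯ × [a_d, a_d + ℓ)` in `ℝ^d` with lower corner `a` and
side length `ℓ` (a cube when `0 < ℓ`). Its faces are Lebesgue null, so every notion below is the
same for open or closed cubes. -/
def cube {d : ℕ} (a : EuclideanSpace ℝ (Fin d)) (ℓ : ℝ) : Set (EuclideanSpace ℝ (Fin d)) :=
  {x | ∀ i, a i ≤ x i ∧ x i < a i + ℓ}

/-- A weight: a locally integrable function that is positive (almost everywhere). -/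
def IsWeight {d : ℕ} (w : EuclideanSpace ℝ (Fin d) → ℝ) : Prop :=
  LocallyIntegrable w volume ∧ ∀ᵐ x ∂volume, 0 < w x

/-- The measure `w dx`, so that `wMeasure w Q` is `w(Q) = ∫_Q w`. -/
def wMeasure {d : ℕ} (w : EuclideanSpace ℝ (Fin d) → ℝ) : Measure (EuclideanSpace ℝ (Fin d)) :=
  volume.withDensity fun x => ENNReal.ofReal (w x)

/-- The average `⟨g⟩_Q = |Q|⁻¹ ∫_Q g` of a nonnegative extended-real function. -/
def eaverage {d : ℕ} (g : EuclideanSpace ℝ (Fin d) → ℝ≥0∞) (Q : Set (EuclideanSpace ℝ (Fin d))) :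
    ℝ≥0∞ :=
  (∫⁻ x in Q, g x) / volume Q

/-- The Muckenhoupt constant: for `1 < p < ∞` it is
`[w]_{A_p} = sup_Q ⟨w⟩_Q ⟨w ^ (-1 / (p - 1))⟩_Q ^ (p - 1)`, and
`[w]_{A_1} = sup_Q ⟨w⟩_Q ‖w⁻¹‖_{L^∞(Q)}`; the suprema are over all cubes. -/
def apConst {d : ℕ} (p : ℝ) (w : EuclideanSpace ℝ (Fin d) → ℝ) : ℝ≥0∞ :=
  ⨆ (a : EuclideanSpace ℝ (Fin d)) (ℓ : ℝ) (_ : 0 < ℓ),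
    eaverage (fun x => ENNReal.ofReal (w x)) (cube a ℓ) *
      if p = 1 then
        essSup (fun x => (ENNReal.ofReal (w x))⁻¹) (volume.restrict (cube a ℓ))
      else
        eaverage (fun x => ENNReal.ofReal (w x) ^ (-1 / (p - 1))) (cube a ℓ) ^ (p - 1)

/-- The Muckenhoupt class `A_p`, `1 ≤ p < ∞`. -/
def MemAp {d : ℕ} (p : ℝ) (w : EuclideanSpace ℝ (Fin d) → ℝ) : Prop :=
  IsWeight w ∧ apConst p w < ∞

/-- The weighted fractional oscillation
`w(Q)^(-α/d) (w(Q)⁻¹ ∫_Q (|f - ⟨f⟩_Q| / w)^r dw)^(1/r)`, with values in `[0, ∞]`. -/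
def osc {d : ℕ} (w : EuclideanSpace ℝ (Fin d) → ℝ) (r α : ℝ) (f : EuclideanSpace ℝ (Fin d) → ℂ)
    (Q : Set (EuclideanSpace ℝ (Fin d))) : ℝ≥0∞ :=
  wMeasure w Q ^ (-α / d) *
    ((wMeasure w Q)⁻¹ *
      ∫⁻ x in Q, (‖f x - ⨍ y in Q, f y‖ₑ / ENNReal.ofReal (w x)) ^ r ∂(wMeasure w)) ^ (1 / r)

/-- The seminorm of `BMO_w^{r,α}`. -/
def bmoNorm {d : ℕ} (w : EuclideanSpace ℝ (Fin d) → ℝ) (r α : ℝ)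
    (f : EuclideanSpace ℝ (Fin d) → ℂ) : ℝ≥0∞ :=
  ⨆ (a : EuclideanSpace ℝ (Fin d)) (ℓ : ℝ) (_ : 0 < ℓ), osc w r α f (cube a ℓ)

/-- The space `BMO_w^{r,α}` of locally integrable complex functions. -/
def BMO {d : ℕ} (w : EuclideanSpace ℝ (Fin d) → ℝ) (r α : ℝ) :
    Set (EuclideanSpace ℝ (Fin d) → ℂ) :=
  {f | LocallyIntegrable f volume ∧ bmoNorm w r α f < ∞}

/-- The space `VMO_w^{r,α}`: the `f` in `BMO_w^{r,α}` whose oscillation tends to zero uniformly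
over small cubes, uniformly over large cubes, and along the translates of each fixed cube. -/
def VMO {d : ℕ} (w : EuclideanSpace ℝ (Fin d) → ℝ) (r α : ℝ) :
    Set (EuclideanSpace ℝ (Fin d) → ℂ) :=
  {f | f ∈ BMO w r α ∧
    Tendsto (fun t : ℝ => ⨆ (a : EuclideanSpace ℝ (Fin d)) (ℓ : ℝ) (_ : 0 < ℓ) (_ : ℓ ≤ t),
      osc w r α f (cube a ℓ)) (𝓝[>] 0) (𝓝 0) ∧
    Tendsto (fun t : ℝ => ⨆ (a : EuclideanSpace ℝ (Fin d)) (ℓ : ℝ) (_ : 0 < ℓ) (_ : t ≤ ℓ),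
      osc w r α f (cube a ℓ)) atTop (𝓝 0) ∧
    ∀ (a : EuclideanSpace ℝ (Fin d)) (ℓ : ℝ), 0 < ℓ →
      Tendsto (fun x => osc w r α f (cube (a + x) ℓ))
        (Bornology.cobounded (EuclideanSpace ℝ (Fin d))) (𝓝 0)}

end

end FracVMO

namespace FracVMO

/-! One inclusion is Jensen's inequality for w dx / w(Q). The other rests on a John–Nirenberg
estimate that records where the oscillation is large. Put σ = w^(1-r). Since r ≤ p', the A_p
condition gives w(Q)^(r-1) σ(Q) ≤ K |Q|^r, hence doubling, and some θ < 1 with w(E) ≤ θ w(Q)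
whenever E ⊆ Q and |E| ≤ |Q|/2.

Suppose every subcube of Q is good (oscillation at exponent 1 at most ε), or lies in a set B and has
oscillation at most M. Stop at the maximal dyadic subcubes on which the average of |f - ⟨f⟩_Q|
exceeds twice the bound available on Q. They fill at most half of Q, |f - ⟨f⟩_Q| is bounded a.e.
outside them, and the argument restarts in each. The L^r(σ) norms then decay geometrically with
ratio θ^(1/r). Charging good cubes to w(Q) and the others to w(Q ∩ B) gives
`DualApBound.exists_osc_le`: the r-oscillation on Q is at most A (ε + M (w(Q ∩ B)/w(Q))^(1/r)). The
iteration is an induction on the generation of dyadic averages of f, so no a priori finiteness of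
the r-oscillation is needed; Lebesgue differentiation and Fatou then pass to f itself.

For f in VMO with exponent 1, all cubes that are not good lie in one fixed cube B
(`exists_osc_one_le_of_mem_VMO`). Small cubes have only good subcubes, far translates miss B, and
for large cubes w(Q ∩ B)/w(Q) is small. -/

/-! ### Cubes and Lebesgue differentiation -/

theorem cube_eq_preimage {d : ℕ} (a : EuclideanSpace ℝ (Fin d)) (ℓ : ℝ) :
    cube a ℓ = WithLp.ofLp ⁻¹' (Set.univ.pi fun i => Set.Ico (a i) (a i + ℓ)) := by
  ext x
  simp [cube]

theorem measurableSet_cube {d : ℕ} (a : EuclideanSpace ℝ (Fin d)) (ℓ : ℝ) :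
    MeasurableSet (cube a ℓ) := by
  rw [cube_eq_preimage]
  exact (PiLp.volume_preserving_ofLp (Fin d)).measurable
    (MeasurableSet.univ_pi fun i => measurableSet_Ico)

theorem volume_cube {d : ℕ} (a : EuclideanSpace ℝ (Fin d)) (ℓ : ℝ) :
    volume (cube a ℓ) = ENNReal.ofReal ℓ ^ d := by
  rw [cube_eq_preimage, (PiLp.volume_preserving_ofLp (Fin d)).measure_preimage
    (MeasurableSet.univ_pi fun i => measurableSet_Ico).nullMeasurableSet, Real.volume_pi_Ico]
  simp

theorem volume_cube_pos {d : ℕ} (a : EuclideanSpace ℝ (Fin d)) {ℓ : ℝ} (hℓ : 0 < ℓ) :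
    volume (cube a ℓ) ≠ 0 := by
  rw [volume_cube]
  exact pow_ne_zero _ (by simpa using hℓ)

theorem volume_cube_ne_top {d : ℕ} (a : EuclideanSpace ℝ (Fin d)) (ℓ : ℝ) :
    volume (cube a ℓ) ≠ ∞ := by
  rw [volume_cube]
  exact ENNReal.pow_ne_top ENNReal.ofReal_ne_top

theorem cube_subset_preimage_Icc {d : ℕ} (a : EuclideanSpace ℝ (Fin d)) (ℓ : ℝ) :
    cube a ℓ ⊆ PiLp.homeomorph 2 (fun _ : Fin d => ℝ) ⁻¹'
      Set.Icc (a.ofLp) (fun i => a i + ℓ) := fun _ hx =>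
  ⟨fun i => (hx i).1, fun i => (hx i).2.le⟩

theorem isCompact_preimage_Icc {d : ℕ} (a b : Fin d → ℝ) :
    IsCompact (PiLp.homeomorph 2 (fun _ : Fin d => ℝ) ⁻¹' Set.Icc a b) :=
  (PiLp.homeomorph 2 (fun _ : Fin d => ℝ)).isCompact_preimage.2 isCompact_Icc

theorem isBounded_cube {d : ℕ} (a : EuclideanSpace ℝ (Fin d)) (ℓ : ℝ) :
    Bornology.IsBounded (cube a ℓ) :=
  (isCompact_preimage_Icc _ _).isBounded.subset (cube_subset_preimage_Icc a ℓ)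

theorem integrableOn_cube {d : ℕ} {G : Type*} [NormedAddCommGroup G]
    {f : EuclideanSpace ℝ (Fin d) → G} (hf : LocallyIntegrable f volume)
    (a : EuclideanSpace ℝ (Fin d)) (ℓ : ℝ) : IntegrableOn f (cube a ℓ) volume :=
  (hf.integrableOn_isCompact (isCompact_preimage_Icc _ _)).mono_set (cube_subset_preimage_Icc a ℓ)

theorem cube_subset_cube {d : ℕ} {a b : EuclideanSpace ℝ (Fin d)} {s t : ℝ}
    (h : ∀ i, a i ≤ b i ∧ b i + s ≤ a i + t) : cube b s ⊆ cube a t := fun _ hx i =>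
  ⟨(h i).1.trans (hx i).1, (hx i).2.trans_le (h i).2⟩

/-- In the sup norm on `Fin d → ℝ` closed cubes are closed balls, so differentiation along balls
that contain x, not necessarily centred there, applies after transport; the faces are null. -/
theorem tendsto_setAverage_cube {d : ℕ} {f : EuclideanSpace ℝ (Fin d) → ℂ}
    (hf : LocallyIntegrable f volume) :
    ∀ᵐ x ∂(volume : Measure (EuclideanSpace ℝ (Fin d))),
      ∀ (b : ℕ → EuclideanSpace ℝ (Fin d)) (s : ℕ → ℝ), Tendsto s atTop (𝓝[>] 0) →
        (∀ n, x ∈ cube (b n) (s n)) →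
        Tendsto (fun n => ⨍ y in cube (b n) (s n), f y) atTop (𝓝 (f x)) := by
  have hmp := PiLp.volume_preserving_ofLp (Fin d)
  set g : (Fin d → ℝ) → ℂ := fun y => f (WithLp.toLp 2 y) with hg
  have hgl : LocallyIntegrable g volume := by
    have := (locallyIntegrable_map_homeomorph (PiLp.homeomorph 2 (fun _ : Fin d => ℝ))
      (f := g) (μ := volume)).2 hf
    have h2 : Measure.map (PiLp.homeomorph 2 (fun _ : Fin d => ℝ)) volume = volume := hmp.map_eq
    rwa [h2] at this
  have key := IsUnifLocDoublingMeasure.ae_tendsto_average (volume : Measure (Fin d → ℝ)) hgl 1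
  filter_upwards [hmp.quasiMeasurePreserving.ae key] with x hx b s hs hxs
  have h1 : Tendsto (fun n => s n / 2) atTop (𝓝[>] 0) := by
    rw [tendsto_nhdsWithin_iff] at hs ⊢
    refine ⟨by simpa using hs.1.div_const 2, ?_⟩
    filter_upwards [hs.2] with n hn
    simp only [Set.mem_Ioi] at hn ⊢
    linarith
  have hpos : ∀ᶠ n in atTop, 0 < s n := by
    rw [tendsto_nhdsWithin_iff] at hs
    exact hs.2
  have hball : ∀ n, 0 < s n → Metric.closedBall (fun i => b n i + s n / 2) (s n / 2)
      = Set.Icc (b n).ofLp (fun i => b n i + s n) := by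
    intro n hn
    rw [closedBall_pi _ (by linarith), ← Set.pi_univ_Icc]
    congr 1
    ext1 i
    rw [Real.closedBall_eq_Icc]
    congr 1 <;> ring
  have h2 := hx (fun n => fun i => b n i + s n / 2) (fun n => s n / 2) h1 (by
    filter_upwards [hpos] with n hn
    rw [one_mul, hball n hn]
    exact ⟨fun i => (hxs n i).1, fun i => (hxs n i).2.le⟩)
  have h3 : g x.ofLp = f x := by simp [hg]
  rw [h3] at h2
  refine h2.congr' ?_
  filter_upwards [hpos] with n hn
  have hae : (Set.univ.pi fun i => Set.Ico (b n i) (b n i + s n)) =ᵐ[volume]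
      Set.Icc (b n).ofLp (fun i => b n i + s n) := Measure.univ_pi_Ico_ae_eq_Icc
  rw [hball n hn, ← setAverage_congr hae, setAverage_eq, setAverage_eq,
    cube_eq_preimage]
  have hme : MeasurableEmbedding (WithLp.ofLp : EuclideanSpace ℝ (Fin d) → (Fin d → ℝ)) :=
    (PiLp.homeomorph 2 (fun _ : Fin d => ℝ)).measurableEmbedding
  congr 1
  · rw [measureReal_def, measureReal_def, hmp.measure_preimage
      (MeasurableSet.univ_pi fun i => measurableSet_Ico).nullMeasurableSet]
  · rw [← hmp.setIntegral_preimage_emb hme]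

/-! ### Dyadic subcubes and averages -/

/-- The lower corner of a dyadic child of `cube a ℓ`. -/
noncomputable def childCorner {d : ℕ} (a : EuclideanSpace ℝ (Fin d)) (ℓ : ℝ) (v : Fin d → Bool) :
    EuclideanSpace ℝ (Fin d) :=
  WithLp.toLp 2 fun i => a i + if v i then ℓ / 2 else 0

/-- The index of the dyadic child of `cube a ℓ` to which `x` belongs. -/
noncomputable def childIndex {d : ℕ} (a : EuclideanSpace ℝ (Fin d)) (ℓ : ℝ)
    (x : EuclideanSpace ℝ (Fin d)) : Fin d → Bool :=
  fun i => decide (a i + ℓ / 2 ≤ x i)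

theorem child_subset {d : ℕ} (a : EuclideanSpace ℝ (Fin d)) {ℓ : ℝ} (hℓ : 0 < ℓ)
    (v : Fin d → Bool) : cube (childCorner a ℓ v) (ℓ / 2) ⊆ cube a ℓ := by
  refine cube_subset_cube fun i => ?_
  simp only [childCorner]
  split_ifs <;> constructor <;> linarith

theorem mem_child_iff {d : ℕ} {a x : EuclideanSpace ℝ (Fin d)} {ℓ : ℝ} (hx : x ∈ cube a ℓ)
    (v : Fin d → Bool) : x ∈ cube (childCorner a ℓ v) (ℓ / 2) ↔ childIndex a ℓ x = v := by
  simp only [cube, Set.mem_ofPred_eq, childCorner, childIndex, funext_iff] at hx ⊢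
  refine forall_congr' fun i => ?_
  have := hx i
  generalize a.ofLp i = α, x.ofLp i = ξ at this ⊢
  cases v i <;> simp <;> intros <;> linarith

theorem iUnion_child {d : ℕ} (a : EuclideanSpace ℝ (Fin d)) {ℓ : ℝ} (hℓ : 0 < ℓ) :
    ⋃ v, cube (childCorner a ℓ v) (ℓ / 2) = cube a ℓ := by
  refine subset_antisymm (Set.iUnion_subset (child_subset a hℓ)) fun x hx => ?_
  exact Set.mem_iUnion.2 ⟨_, (mem_child_iff hx _).2 rfl⟩

theorem pairwise_disjoint_child {d : ℕ} (a : EuclideanSpace ℝ (Fin d)) {ℓ : ℝ} (hℓ : 0 < ℓ) :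
    Pairwise fun v v' => Disjoint (cube (childCorner a ℓ v) (ℓ / 2))
      (cube (childCorner a ℓ v') (ℓ / 2)) := by
  intro v v' hv
  refine Set.disjoint_left.2 fun x h h' => hv ?_
  have hx := child_subset a hℓ v h
  rw [← (mem_child_iff hx _).1 h, ← (mem_child_iff hx _).1 h']

theorem volume_child {d : ℕ} (a : EuclideanSpace ℝ (Fin d)) {ℓ : ℝ}
    (v : Fin d → Bool) :
    2 ^ d * volume (cube (childCorner a ℓ v) (ℓ / 2)) = volume (cube a ℓ) := by
  rw [volume_cube, volume_cube, ← mul_pow]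
  congr 1
  rw [← ENNReal.ofReal_ofNat 2, ← ENNReal.ofReal_mul (by norm_num)]
  congr 1
  ring

/-- The average of `f` over the dyadic descendant of generation `n` of `cube a ℓ` to which `x`
belongs. -/
noncomputable def dyadicAverage {d : ℕ} (f : EuclideanSpace ℝ (Fin d) → ℂ) :
    ℕ → EuclideanSpace ℝ (Fin d) → ℝ → EuclideanSpace ℝ (Fin d) → ℂ
  | 0, a, ℓ, _ => ⨍ y in cube a ℓ, f y
  | n + 1, a, ℓ, x => dyadicAverage f n (childCorner a ℓ (childIndex a ℓ x)) (ℓ / 2) x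

theorem exists_dyadicAverage_eq {d : ℕ} (f : EuclideanSpace ℝ (Fin d) → ℂ) (n : ℕ) :
    ∀ {a x : EuclideanSpace ℝ (Fin d)} {ℓ : ℝ}, x ∈ cube a ℓ →
      ∃ b, x ∈ cube b (ℓ / 2 ^ n) ∧ dyadicAverage f n a ℓ x = ⨍ y in cube b (ℓ / 2 ^ n), f y := by
  induction n with
  | zero =>
    intro a x ℓ hx
    exact ⟨a, by simpa using hx, by simp [dyadicAverage]⟩
  | succ n ih =>
    intro a x ℓ hx
    obtain ⟨b, hb, hb'⟩ := ih ((mem_child_iff hx _).2 rfl)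
    have : ℓ / 2 / 2 ^ n = ℓ / 2 ^ (n + 1) := by rw [pow_succ]; field_simp
    rw [this] at hb hb'
    exact ⟨b, hb, hb'⟩

theorem tendsto_dyadicAverage {d : ℕ} {f : EuclideanSpace ℝ (Fin d) → ℂ}
    (hf : LocallyIntegrable f volume) (a : EuclideanSpace ℝ (Fin d)) {ℓ : ℝ} (hℓ : 0 < ℓ) :
    ∀ᵐ x ∂(volume : Measure (EuclideanSpace ℝ (Fin d))), x ∈ cube a ℓ →
      Tendsto (fun n => dyadicAverage f n a ℓ x) atTop (𝓝 (f x)) := by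
  filter_upwards [tendsto_setAverage_cube hf] with x hx hxa
  choose b hb hb' using fun n => exists_dyadicAverage_eq f n hxa
  simp_rw [hb']
  refine hx b _ ?_ hb
  rw [tendsto_nhdsWithin_iff]
  refine ⟨?_, Eventually.of_forall fun n => by simp only [Set.mem_Ioi]; positivity⟩
  exact tendsto_const_nhds.div_atTop (tendsto_pow_atTop_atTop_of_one_lt (by norm_num))

theorem enorm_setAverage_sub_le {d : ℕ} {f : EuclideanSpace ℝ (Fin d) → ℂ}
    (hf : LocallyIntegrable f volume) (a : EuclideanSpace ℝ (Fin d)) {ℓ : ℝ} (hℓ : 0 < ℓ) (κ : ℂ) :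
    ‖(⨍ y in cube a ℓ, f y) - κ‖ₑ ≤ (volume (cube a ℓ))⁻¹ * ∫⁻ y in cube a ℓ, ‖f y - κ‖ₑ := by
  have h0 := volume_cube_pos a hℓ
  have ht := volume_cube_ne_top a ℓ
  have h1 : (⨍ y in cube a ℓ, f y) - κ = ⨍ y in cube a ℓ, (f y - κ) := by
    have h2 := setAverage_const h0 ht κ
    rw [setAverage_eq] at h2 ⊢
    rw [setAverage_eq, integral_sub (integrableOn_cube hf a ℓ) (integrableOn_const ht), smul_sub,
      h2]
  rw [h1, setAverage_eq, enorm_smul]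
  refine mul_le_mul' (le_of_eq ?_) (enorm_integral_le_lintegral_enorm _)
  rw [Real.enorm_eq_ofReal (by positivity), measureReal_def, ENNReal.ofReal_inv_of_pos
    (ENNReal.toReal_pos h0 ht), ENNReal.ofReal_toReal ht]

theorem lintegral_rpow_le_rpow_lintegral {X : Type*} [MeasurableSpace X] {μ : Measure X}
    {g : X → ℝ≥0∞} (hg : AEMeasurable g μ) {s : ℝ} (hs : 0 < s) (hs1 : s ≤ 1) :
    ∫⁻ x, g x ^ s ∂μ ≤ (∫⁻ x, g x ∂μ) ^ s * μ Set.univ ^ (1 - s) := by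
  have h := eLpNorm'_le_eLpNorm'_mul_rpow_measure_univ hs hs1 hg.aestronglyMeasurable
  simp only [eLpNorm'_eq_lintegral_enorm, enorm_eq_self, ENNReal.rpow_one, div_one] at h
  have h2 := ENNReal.rpow_le_rpow h hs.le
  rw [ENNReal.mul_rpow_of_nonneg _ _ hs.le, ← ENNReal.rpow_mul, ← ENNReal.rpow_mul,
    one_div_mul_cancel hs.ne', ENNReal.rpow_one] at h2
  convert h2 using 3
  field_simp

/-! ### Consequences of the Muckenhoupt condition -/

section Weight

variable {d : ℕ} {w : EuclideanSpace ℝ (Fin d) → ℝ}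

theorem IsWeight.aemeasurable_ofReal (hw : IsWeight w) :
    AEMeasurable (fun x => ENNReal.ofReal (w x)) volume :=
  hw.1.aestronglyMeasurable.aemeasurable.ennreal_ofReal

theorem IsWeight.ae_ofReal_ne_zero (hw : IsWeight w) :
    ∀ᵐ x ∂volume, ENNReal.ofReal (w x) ≠ 0 := by
  filter_upwards [hw.2] with x hx
  simpa using hx

theorem wMeasure_apply {s : Set (EuclideanSpace ℝ (Fin d))} (hs : MeasurableSet s) :
    wMeasure w s = ∫⁻ x in s, ENNReal.ofReal (w x) := withDensity_apply _ hs

theorem wMeasure_absolutelyContinuous : wMeasure w ≪ volume :=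
  withDensity_absolutelyContinuous _ _

theorem IsWeight.wMeasure_cube_ne_top (hw : IsWeight w) (a : EuclideanSpace ℝ (Fin d)) (ℓ : ℝ) :
    wMeasure w (cube a ℓ) ≠ ∞ := by
  rw [wMeasure_apply (measurableSet_cube a ℓ)]
  exact (integrableOn_cube hw.1 a ℓ).lintegral_lt_top.ne

theorem IsWeight.wMeasure_cube_ne_zero (hw : IsWeight w) (a : EuclideanSpace ℝ (Fin d)) {ℓ : ℝ}
    (hℓ : 0 < ℓ) : wMeasure w (cube a ℓ) ≠ 0 := by
  intro h
  rw [wMeasure_apply (measurableSet_cube a ℓ),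
    lintegral_eq_zero_iff' hw.aemeasurable_ofReal.restrict] at h
  have h3 : ∀ᵐ _ ∂volume.restrict (cube a ℓ), False := by
    filter_upwards [h, ae_restrict_of_ae hw.ae_ofReal_ne_zero] with x hx hx'
    exact hx' hx
  rw [ae_iff] at h3
  simp only [not_false_eq_true, Set.ofPred_true, Measure.restrict_apply_univ] at h3
  exact volume_cube_pos a hℓ h3

/-- The Muckenhoupt condition written for the exponent conjugate to `r`. -/
def DualApBound (w : EuclideanSpace ℝ (Fin d) → ℝ) (r : ℝ) (K : ℝ≥0∞) : Prop :=
  ∀ (a : EuclideanSpace ℝ (Fin d)) (ℓ : ℝ), 0 < ℓ →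
    wMeasure w (cube a ℓ) ^ (r - 1) * ∫⁻ x in cube a ℓ, ENNReal.ofReal (w x) ^ (1 - r) ≤
      K * volume (cube a ℓ) ^ r

theorem MemAp.exists_dualApBound {p r : ℝ} (hw : MemAp p w) (hp : 1 ≤ p) (hr : 1 < r)
    (hrp : ENNReal.ofReal r ≤ ENNReal.conjExponent (ENNReal.ofReal p)) :
    ∃ K, K ≠ ∞ ∧ DualApBound w r K := by
  have hr1 : 0 < r - 1 := by linarith
  refine ⟨apConst p w ^ (r - 1), ENNReal.rpow_ne_top_of_nonneg hr1.le hw.2.ne, fun a ℓ hℓ => ?_⟩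
  have hV0 := volume_cube_pos a hℓ
  have hVt := volume_cube_ne_top a ℓ
  have hA : _ ≤ apConst p w := le_iSup_of_le a (le_iSup_of_le ℓ (le_iSup_of_le hℓ le_rfl))
  rw [eaverage, ← wMeasure_apply (measurableSet_cube a ℓ)] at hA
  set V := volume (cube a ℓ)
  set W := wMeasure w (cube a ℓ)
  have hW : W ^ (r - 1) = (W / V) ^ (r - 1) * V ^ (r - 1) := by
    rw [← ENNReal.mul_rpow_of_nonneg _ _ hr1.le, ENNReal.div_mul_cancel hV0 hVt]
  rcases hp.eq_or_lt with rfl | hp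
  · rw [if_pos rfl] at hA
    set S := essSup (fun x => (ENNReal.ofReal (w x))⁻¹) (volume.restrict (cube a ℓ))
    have hS : ∫⁻ x in cube a ℓ, ENNReal.ofReal (w x) ^ (1 - r) ≤ S ^ (r - 1) * V := by
      calc ∫⁻ x in cube a ℓ, ENNReal.ofReal (w x) ^ (1 - r)
          ≤ ∫⁻ _ in cube a ℓ, S ^ (r - 1) := by
            refine lintegral_mono_ae ?_
            filter_upwards [ENNReal.ae_le_essSup (μ := volume.restrict (cube a ℓ))
              fun x => (ENNReal.ofReal (w x))⁻¹] with x hx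
            rw [show 1 - r = -(r - 1) by ring, ENNReal.rpow_neg, ← ENNReal.inv_rpow]
            exact ENNReal.rpow_le_rpow hx hr1.le
        _ = S ^ (r - 1) * V := by rw [setLIntegral_const]
    calc _ ≤ (W / V) ^ (r - 1) * V ^ (r - 1) * (S ^ (r - 1) * V) := by rw [hW]; gcongr
      _ = (W / V * S) ^ (r - 1) * (V ^ (r - 1) * V ^ (1 : ℝ)) := by
        rw [ENNReal.mul_rpow_of_nonneg _ _ hr1.le, ENNReal.rpow_one]; ring
      _ = (W / V * S) ^ (r - 1) * V ^ r := by
        rw [← ENNReal.rpow_add _ _ hV0 hVt, sub_add_cancel]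
      _ ≤ _ := by gcongr
  · rw [if_neg hp.ne', eaverage] at hA
    have hp1 : 0 < p - 1 := by linarith
    -- w^(1-r) is the s-th power of w^(-1/(p-1)), and r ≤ p' is exactly s ≤ 1, the range in which
    -- Jensen applies.
    set s := (r - 1) * (p - 1) with hs
    have hs0 : 0 < s := by positivity
    have hs1 : s ≤ 1 := by
      have : ENNReal.conjExponent (ENNReal.ofReal p) = ENNReal.ofReal (1 + (p - 1)⁻¹) := by
        rw [ENNReal.conjExponent, ENNReal.ofReal_add zero_le_one (by positivity),
          ENNReal.ofReal_inv_of_pos hp1, ENNReal.ofReal_sub _ zero_le_one, ENNReal.ofReal_one]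
      rw [this, ENNReal.ofReal_le_ofReal_iff (by positivity)] at hrp
      rw [hs, ← le_div_iff₀ hp1]
      simpa using by linarith
    set G := ∫⁻ x in cube a ℓ, ENNReal.ofReal (w x) ^ (-1 / (p - 1))
    have hG : ∫⁻ x in cube a ℓ, ENNReal.ofReal (w x) ^ (1 - r) ≤ G ^ s * V ^ (1 - s) := by
      have h := lintegral_rpow_le_rpow_lintegral (μ := volume.restrict (cube a ℓ))
        (g := fun x => ENNReal.ofReal (w x) ^ (-1 / (p - 1)))
        (hw.1.aemeasurable_ofReal.restrict.pow_const _) hs0 hs1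
      rw [Measure.restrict_apply_univ] at h
      refine le_trans (le_of_eq ?_) h
      refine lintegral_congr fun x => ?_
      rw [← ENNReal.rpow_mul]
      congr 1
      rw [hs]
      field_simp
      ring
    have hGV : G ^ s = (G / V) ^ s * V ^ s := by
      rw [← ENNReal.mul_rpow_of_nonneg _ _ hs0.le, ENNReal.div_mul_cancel hV0 hVt]
    calc _ ≤ (W / V) ^ (r - 1) * V ^ (r - 1) * ((G / V) ^ s * V ^ s * V ^ (1 - s)) := by
          rw [hW, ← hGV]; gcongr
      _ = (W / V * (G / V) ^ (p - 1)) ^ (r - 1) * (V ^ (r - 1) * (V ^ s * V ^ (1 - s))) := by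
        rw [ENNReal.mul_rpow_of_nonneg _ _ hr1.le, ← ENNReal.rpow_mul, mul_comm (p - 1)]; ring
      _ = (W / V * (G / V) ^ (p - 1)) ^ (r - 1) * V ^ r := by
        rw [← ENNReal.rpow_add _ _ hV0 hVt, ← ENNReal.rpow_add _ _ hV0 hVt]
        congr 2; ring
      _ ≤ _ := by gcongr

variable {r : ℝ} {K : ℝ≥0∞}

/-- Hölder on s for 1 = w^((r-1)/r) · w^(-(r-1)/r); the second factor is then enlarged to an
integral over the whole cube. -/
theorem DualApBound.volume_rpow_le (hK : DualApBound w r K) (hw : IsWeight w) (hr : 1 < r)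
    (a : EuclideanSpace ℝ (Fin d)) {ℓ : ℝ} (hℓ : 0 < ℓ) {s : Set (EuclideanSpace ℝ (Fin d))}
    (hs : MeasurableSet s) (hsub : s ⊆ cube a ℓ) :
    volume s ^ r * wMeasure w (cube a ℓ) ^ (r - 1) ≤
      K * volume (cube a ℓ) ^ r * wMeasure w s ^ (r - 1) := by
  have hr0 : 0 < r := by linarith
  have hr1 : 0 < r - 1 := by linarith
  have hu := hw.aemeasurable_ofReal
  have hpq : (r / (r - 1)).HolderConjugate r := (Real.HolderConjugate.conjExponent hr).symm
  have h := ENNReal.lintegral_mul_le_Lp_mul_Lq (volume.restrict s) hpq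
    (hu.restrict.pow_const ((r - 1) / r)) (hu.restrict.pow_const (-((r - 1) / r)))
  have h1 : volume s ≤ wMeasure w s ^ ((r - 1) / r) *
      (∫⁻ x in s, ENNReal.ofReal (w x) ^ (1 - r)) ^ (1 / r) := by
    calc volume s = ∫⁻ _ in s, 1 := by simp
      _ = _ := lintegral_congr_ae ?_
      _ ≤ _ := h
      _ = _ := ?_
    · filter_upwards [ae_restrict_of_ae hw.ae_ofReal_ne_zero] with x hx
      rw [Pi.mul_apply, ← ENNReal.rpow_add _ _ hx ENNReal.ofReal_ne_top, add_neg_cancel,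
        ENNReal.rpow_zero]
    · rw [wMeasure_apply hs]
      simp_rw [← ENNReal.rpow_mul]
      congr 2
      · refine lintegral_congr fun x => ?_
        rw [show (r - 1) / r * (r / (r - 1)) = 1 by field_simp, ENNReal.rpow_one]
      · field_simp
      · refine lintegral_congr fun x => ?_
        congr 1
        field_simp
        ring
  have h2 := ENNReal.rpow_le_rpow h1 hr0.le
  rw [ENNReal.mul_rpow_of_nonneg _ _ hr0.le, ← ENNReal.rpow_mul, ← ENNReal.rpow_mul,
    div_mul_cancel₀ _ hr0.ne', one_div_mul_cancel hr0.ne', ENNReal.rpow_one] at h2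
  calc _ ≤ (wMeasure w s ^ (r - 1) * ∫⁻ x in cube a ℓ, ENNReal.ofReal (w x) ^ (1 - r)) *
        wMeasure w (cube a ℓ) ^ (r - 1) := by
        gcongr
        exact h2.trans (by gcongr)
    _ = (wMeasure w (cube a ℓ) ^ (r - 1) * ∫⁻ x in cube a ℓ, ENNReal.ofReal (w x) ^ (1 - r)) *
        wMeasure w s ^ (r - 1) := by ring
    _ ≤ _ := mul_le_mul' (hK a ℓ hℓ) le_rfl

theorem DualApBound.wMeasure_le (hK : DualApBound w r K) (hw : IsWeight w) (hr : 1 < r)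
    (a : EuclideanSpace ℝ (Fin d)) {ℓ : ℝ} (hℓ : 0 < ℓ) {s : Set (EuclideanSpace ℝ (Fin d))}
    (hs : MeasurableSet s) (hsub : s ⊆ cube a ℓ) {L : ℝ≥0∞}
    (hL : volume (cube a ℓ) ≤ L * volume s) :
    wMeasure w (cube a ℓ) ≤ (K * L ^ r) ^ (r - 1)⁻¹ * wMeasure w s := by
  have hr0 : 0 < r := by linarith
  have hr1 : 0 < r - 1 := by linarith
  have hs0 : volume s ≠ 0 := fun h => volume_cube_pos a hℓ (by simpa [h] using hL)
  have hst : volume s ≠ ∞ := ((measure_mono hsub).trans_lt (volume_cube_ne_top a ℓ).lt_top).ne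
  have h1 : volume s ^ r * wMeasure w (cube a ℓ) ^ (r - 1) ≤
      volume s ^ r * (K * L ^ r * wMeasure w s ^ (r - 1)) := by
    refine (hK.volume_rpow_le hw hr a hℓ hs hsub).trans ?_
    calc _ ≤ K * (L * volume s) ^ r * wMeasure w s ^ (r - 1) := by gcongr
      _ = _ := by rw [ENNReal.mul_rpow_of_nonneg _ _ hr0.le]; ring
  rw [ENNReal.mul_le_mul_iff_right (by simp [ENNReal.rpow_eq_zero_iff, hs0, hst])
    (ENNReal.rpow_ne_top_of_nonneg hr0.le hst)] at h1
  have h2 := ENNReal.rpow_le_rpow h1 (inv_nonneg.2 hr1.le)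
  rwa [ENNReal.mul_rpow_of_nonneg _ _ (inv_nonneg.2 hr1.le), ← ENNReal.rpow_mul,
    ← ENNReal.rpow_mul, mul_inv_cancel₀ hr1.ne', ENNReal.rpow_one, ENNReal.rpow_one] at h2

/-- The complement of s fills at least half of the cube, so it carries at least the fraction D⁻¹ of
the weight; θ = 1 - D⁻¹. -/
theorem DualApBound.exists_wMeasure_le_of_half (hK : DualApBound w r K) (hKt : K ≠ ∞)
    (hw : IsWeight w) (hr : 1 < r) :
    ∃ θ < (1 : ℝ≥0∞), ∀ (a : EuclideanSpace ℝ (Fin d)) (ℓ : ℝ), 0 < ℓ →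
      ∀ s, MeasurableSet s → s ⊆ cube a ℓ → 2 * volume s ≤ volume (cube a ℓ) →
        wMeasure w s ≤ θ * wMeasure w (cube a ℓ) := by
  have hr0 : 0 < r := by linarith
  have hr1 : 0 < r - 1 := by linarith
  -- The summand 1 keeps D nonzero, so that D⁻¹ is finite.
  set D := (K * 2 ^ r) ^ (r - 1)⁻¹ + 1 with hD
  have hDt : D ≠ ∞ := ENNReal.add_ne_top.2 ⟨ENNReal.rpow_ne_top_of_nonneg (inv_nonneg.2 hr1.le)
    (ENNReal.mul_ne_top hKt (ENNReal.rpow_ne_top_of_nonneg hr0.le (by simp))), by simp⟩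
  have hD0 : D ≠ 0 := by simp [hD]
  refine ⟨1 - D⁻¹, ENNReal.sub_lt_self (by simp) (by simp) (by simpa using hDt), ?_⟩
  intro a ℓ hℓ s hs hsub h2
  have hst : volume s ≠ ∞ := ((measure_mono hsub).trans_lt (volume_cube_ne_top a ℓ).lt_top).ne
  have hdiff : MeasurableSet (cube a ℓ \ s) := (measurableSet_cube a ℓ).diff hs
  have hvol : volume (cube a ℓ) ≤ 2 * volume (cube a ℓ \ s) := by
    rw [measure_sdiff hsub hs.nullMeasurableSet hst, ENNReal.mul_sub (by simp)]
    rw [two_mul]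
    exact ENNReal.le_sub_of_add_le_right (ENNReal.mul_ne_top (by simp) hst) (by gcongr)
  have h3 := hK.wMeasure_le hw hr a hℓ hdiff Set.sdiff_subset hvol
  have h4 : wMeasure w (cube a ℓ) ≤ D * wMeasure w (cube a ℓ \ s) :=
    h3.trans (by gcongr; exact le_self_add)
  have h5 : D⁻¹ * wMeasure w (cube a ℓ) ≤ wMeasure w (cube a ℓ \ s) := by
    rw [mul_comm, ← div_eq_mul_inv]
    exact ENNReal.div_le_of_le_mul' h4
  have hWt := hw.wMeasure_cube_ne_top a ℓ
  rw [ENNReal.sub_mul (fun _ _ => hWt), one_mul]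
  refine ENNReal.le_sub_of_add_le_right
    (ENNReal.mul_ne_top (ENNReal.inv_ne_top.2 hD0) hWt) ?_
  calc _ ≤ wMeasure w s + wMeasure w (cube a ℓ \ s) := by gcongr
    _ = wMeasure w (cube a ℓ) := by
      rw [add_comm]
      nth_rewrite 2 [← Set.inter_eq_right.2 hsub]
      exact measure_sdiff_add_inter _ hs

theorem DualApBound.exists_doubling (hK : DualApBound w r K) (hKt : K ≠ ∞) (hw : IsWeight w)
    (hr : 1 < r) (L : ℝ) :
    ∃ C : ℝ≥0∞, C ≠ ∞ ∧ ∀ (a b : EuclideanSpace ℝ (Fin d)) (ℓ s : ℝ), 0 < ℓ → 0 < s → ℓ ≤ L * s →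
      cube b s ⊆ cube a ℓ → wMeasure w (cube a ℓ) ≤ C * wMeasure w (cube b s) := by
  have hr0 : 0 < r := by linarith
  have hr1 : 0 < r - 1 := by linarith
  refine ⟨(K * (ENNReal.ofReal L ^ d) ^ r) ^ (r - 1)⁻¹, ?_, ?_⟩
  · exact ENNReal.rpow_ne_top_of_nonneg (inv_nonneg.2 hr1.le)
      (ENNReal.mul_ne_top hKt (ENNReal.rpow_ne_top_of_nonneg hr0.le (by simp)))
  · intro a b ℓ s hℓ hs hL hsub
    refine hK.wMeasure_le hw hr a hℓ (measurableSet_cube b s) hsub ?_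
    rw [volume_cube, volume_cube, ← mul_pow, ← ENNReal.ofReal_mul' hs.le]
    gcongr

/-- Each doubling of the side gains a factor θ, because for d ≥ 1 a cube fills at most half of its
double. A large cube that meets the given one is comparable, by doubling, to a cube containing its
k-th double. -/
theorem DualApBound.wMeasure_cube_le_mul_large (hK : DualApBound w r K) (hKt : K ≠ ∞)
    (hw : IsWeight w) (hr : 1 < r) (hd : 1 ≤ d) (a : EuclideanSpace ℝ (Fin d)) {ℓ : ℝ}
    (hℓ : 0 < ℓ) {η : ℝ≥0∞} (hη : η ≠ 0) :
    ∃ T : ℝ, ∀ (b : EuclideanSpace ℝ (Fin d)) (s : ℝ), T ≤ s → (cube b s ∩ cube a ℓ).Nonempty →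
      wMeasure w (cube a ℓ) ≤ η * wMeasure w (cube b s) := by
  obtain ⟨θ, hθ, hhalf⟩ := hK.exists_wMeasure_le_of_half hKt hw hr
  obtain ⟨C, hCt, hC⟩ := hK.exists_doubling hKt hw hr 3
  have hchain : ∀ k : ℕ, wMeasure w (cube a ℓ) ≤ θ ^ k * wMeasure w (cube a (2 ^ k * ℓ)) := by
    intro k
    induction k with
    | zero => simp
    | succ k ih =>
      refine ih.trans ?_
      rw [pow_succ, mul_assoc]
      gcongr
      refine hhalf a _ (by positivity) _ (measurableSet_cube _ _) (cube_subset_cube fun i => ?_) ?_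
      · have : 0 < 2 ^ k * ℓ := by positivity
        rw [pow_succ]
        constructor <;> linarith
      · rw [volume_cube, volume_cube, show (2 : ℝ) ^ (k + 1) * ℓ = 2 * (2 ^ k * ℓ) by ring,
          ENNReal.ofReal_mul (p := 2) (by simp), mul_pow, ENNReal.ofReal_ofNat]
        gcongr
        exact le_self_pow₀ (by simp) (by omega)
  have hlim : Tendsto (fun k : ℕ => θ ^ k * C) atTop (𝓝 0) := by
    simpa using ENNReal.Tendsto.mul_const (ENNReal.tendsto_pow_atTop_nhds_zero_of_lt_one hθ)
      (Or.inr hCt)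
  obtain ⟨k, hk⟩ := (hlim.eventually_le_const (pos_iff_ne_zero.2 hη)).exists
  refine ⟨2 ^ k * ℓ, fun b s hs ⟨x, hxb, hxa⟩ => ?_⟩
  have hk1 : ℓ ≤ 2 ^ k * ℓ := le_mul_of_one_le_left hℓ.le (one_le_pow₀ (by norm_num))
  -- The threefold enlargement of `cube b s`. It contains `cube a (2 ^ k * ℓ)`, since the cubes meet
  -- and ℓ ≤ 2^k ℓ ≤ s.
  set b' : EuclideanSpace ℝ (Fin d) := WithLp.toLp 2 fun i => b i - s with hb'
  calc _ ≤ θ ^ k * wMeasure w (cube a (2 ^ k * ℓ)) := hchain k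
    _ ≤ θ ^ k * wMeasure w (cube b' (3 * s)) := by
      gcongr
      refine cube_subset_cube fun i => ?_
      have h1 := hxa i
      have h2 := hxb i
      simp only [hb']
      constructor <;> linarith
    _ ≤ θ ^ k * (C * wMeasure w (cube b s)) := by
      gcongr
      refine hC _ _ _ _ (by linarith) (by linarith) le_rfl (cube_subset_cube fun i => ?_)
      simp only [hb']
      constructor <;> linarith
    _ ≤ _ := by rw [← mul_assoc]; gcongr

end Weight

/-! ### The John–Nirenberg iteration with good and bad cubes -/

section Majorant

variable {d : ℕ}

/-- `g ≤ c + h₁ + h₂` on `P`, where the `L^r(σ)` norms of `h₁` and `h₂` on `P` are controlled by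
`μ E` and `μ (E ∩ B)`. -/
def HasMajorant (μ σ : Measure (EuclideanSpace ℝ (Fin d))) (r : ℝ) (X Y : ℝ≥0∞)
    (B P E : Set (EuclideanSpace ℝ (Fin d))) (c : ℝ≥0∞) (g : EuclideanSpace ℝ (Fin d) → ℝ≥0∞) :
    Prop :=
  ∃ h₁ h₂ : EuclideanSpace ℝ (Fin d) → ℝ≥0∞, Measurable h₁ ∧ Measurable h₂ ∧
    (∀ x ∈ P, g x ≤ c + h₁ x + h₂ x) ∧
    ∫⁻ x in P, h₁ x ^ r ∂σ ≤ X * μ E ∧ ∫⁻ x in P, h₂ x ^ r ∂σ ≤ Y * μ (E ∩ B)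

variable {μ σ : Measure (EuclideanSpace ℝ (Fin d))} {r : ℝ} {X Y : ℝ≥0∞}
  {B : Set (EuclideanSpace ℝ (Fin d))}

theorem HasMajorant.glue_children (hB : MeasurableSet B) {a : EuclideanSpace ℝ (Fin d)} {ℓ : ℝ}
    (hℓ : 0 < ℓ) {E : (Fin d → Bool) → Set (EuclideanSpace ℝ (Fin d))}
    (hE : ∀ v, MeasurableSet (E v)) (hEsub : ∀ v, E v ⊆ cube (childCorner a ℓ v) (ℓ / 2))
    {c : ℝ≥0∞} {g : EuclideanSpace ℝ (Fin d) → ℝ≥0∞}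
    (h : ∀ v, HasMajorant μ σ r X Y B (cube (childCorner a ℓ v) (ℓ / 2)) (E v) c g) :
    HasMajorant μ σ r X Y B (cube a ℓ) (⋃ v, E v) c g := by
  choose h₁ h₂ hm₁ hm₂ hle hi₁ hi₂ using h
  set R : (Fin d → Bool) → Set (EuclideanSpace ℝ (Fin d)) :=
    fun v => cube (childCorner a ℓ v) (ℓ / 2) with hR
  have hRm : ∀ v, MeasurableSet (R v) := fun v => measurableSet_cube _ _
  have hRd := pairwise_disjoint_child a hℓ
  have heval : ∀ (k : (Fin d → Bool) → EuclideanSpace ℝ (Fin d) → ℝ≥0∞) (v : Fin d → Bool),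
      ∀ x ∈ R v, (∑ v', (R v').indicator (k v') x) = k v x := by
    intro k v x hx
    rw [Finset.sum_eq_single v _ (by simp), Set.indicator_of_mem hx]
    intro v' _ hv'
    exact Set.indicator_of_notMem (fun hx' => Set.disjoint_left.1 (hRd hv') hx' hx) _
  have hint : ∀ (k : (Fin d → Bool) → EuclideanSpace ℝ (Fin d) → ℝ≥0∞) (Z : ℝ≥0∞)
      (F : (Fin d → Bool) → Set (EuclideanSpace ℝ (Fin d))), (∀ v, MeasurableSet (F v)) →
      (∀ v, F v ⊆ R v) → (∀ v, ∫⁻ x in R v, k v x ^ r ∂σ ≤ Z * μ (F v)) →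
      ∫⁻ x in cube a ℓ, (∑ v, (R v).indicator (k v) x) ^ r ∂σ ≤ Z * μ (⋃ v, F v) := by
    intro k Z F hF hFR hk
    rw [← iUnion_child a hℓ, lintegral_iUnion hRm hRd,
      measure_iUnion (fun v v' hv => (hRd hv).mono (hFR v) (hFR v')) hF, ← ENNReal.tsum_mul_left]
    refine ENNReal.tsum_le_tsum fun v => le_trans (le_of_eq ?_) (hk v)
    refine setLIntegral_congr_fun (hRm v) fun x hx => ?_
    simp only [heval k v x hx]
  refine ⟨fun x => ∑ v, (R v).indicator (h₁ v) x, fun x => ∑ v, (R v).indicator (h₂ v) x,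
    Finset.measurable_sum _ fun v _ => (hm₁ v).indicator (hRm v),
    Finset.measurable_sum _ fun v _ => (hm₂ v).indicator (hRm v), fun x hx => ?_,
    hint h₁ X E hE hEsub hi₁, ?_⟩
  · have hx' := (mem_child_iff hx _).2 rfl
    simp only [heval h₁ _ x hx', heval h₂ _ x hx']
    exact hle _ x hx'
  · rw [Set.iUnion_inter]
    exact hint h₂ Y _ (fun v => (hE v).inter hB)
      (fun v => Set.inter_subset_left.trans (hEsub v)) hi₂

theorem HasMajorant.congr {P E : Set (EuclideanSpace ℝ (Fin d))} {c : ℝ≥0∞}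
    {g g' : EuclideanSpace ℝ (Fin d) → ℝ≥0∞} (h : HasMajorant μ σ r X Y B P E c g)
    (hg : ∀ x ∈ P, g' x ≤ g x) : HasMajorant μ σ r X Y B P E c g' := by
  obtain ⟨h₁, h₂, hm₁, hm₂, hle, hi⟩ := h
  exact ⟨h₁, h₂, hm₁, hm₂, fun x hx => (hg x hx).trans (hle x hx), hi⟩

variable {f : EuclideanSpace ℝ (Fin d) → ℂ} {Q : Set (EuclideanSpace ℝ (Fin d))}

/-- A stopping-time decomposition of a cube, at the first dyadic subcubes of generation at most `n`
on which the average of `|f - κ|` exceeds `t`. -/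
theorem exists_stopping (hf : LocallyIntegrable f volume) (hB : MeasurableSet B) (hr : 0 < r)
    {n : ℕ}
    (hD : ∀ m < n, ∀ a ℓ, 0 < ℓ → cube a ℓ ⊆ Q → HasMajorant μ σ r X Y B (cube a ℓ) (cube a ℓ) 0
      fun x => ‖dyadicAverage f m a ℓ x - ⨍ y in cube a ℓ, f y‖ₑ) (κ : ℂ) (t : ℝ≥0∞) :
    ∀ a ℓ, 0 < ℓ → cube a ℓ ⊆ Q → ∫⁻ x in cube a ℓ, ‖f x - κ‖ₑ ≤ t * volume (cube a ℓ) →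
      ∃ E ⊆ cube a ℓ, MeasurableSet E ∧ t * volume E ≤ ∫⁻ x in E, ‖f x - κ‖ₑ ∧
        HasMajorant μ σ r X Y B (cube a ℓ) E (2 ^ d * t) fun x => ‖dyadicAverage f n a ℓ x - κ‖ₑ := by
  induction n with
  | zero =>
    intro a ℓ hℓ _ ht
    -- The average of generation 0 is a constant, already controlled by t, so nothing is stopped.
    refine ⟨∅, Set.empty_subset _, MeasurableSet.empty, by simp, 0, 0, measurable_const,
      measurable_const, fun x _ => ?_, by simp [hr], by simp [hr]⟩
    simp only [dyadicAverage, Pi.zero_apply, add_zero]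
    calc _ ≤ (volume (cube a ℓ))⁻¹ * (t * volume (cube a ℓ)) :=
        (enorm_setAverage_sub_le hf a hℓ κ).trans (by gcongr)
      _ = t := by
        rw [mul_comm t, ← mul_assoc, ENNReal.inv_mul_cancel (volume_cube_pos a hℓ)
          (volume_cube_ne_top a ℓ), one_mul]
      _ ≤ 2 ^ d * t := le_mul_of_one_le_left zero_le (one_le_pow₀ (by norm_num))
  | succ n ih =>
    intro a ℓ hℓ hQ ht
    have hℓ2 : 0 < ℓ / 2 := by linarith
    have hstep : ∀ v, ∃ E ⊆ cube (childCorner a ℓ v) (ℓ / 2), MeasurableSet E ∧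
        t * volume E ≤ ∫⁻ x in E, ‖f x - κ‖ₑ ∧
        HasMajorant μ σ r X Y B (cube (childCorner a ℓ v) (ℓ / 2)) E (2 ^ d * t)
          fun x => ‖dyadicAverage f n (childCorner a ℓ v) (ℓ / 2) x - κ‖ₑ := by
      intro v
      have hsub := child_subset a hℓ v
      by_cases hv : ∫⁻ x in cube (childCorner a ℓ v) (ℓ / 2), ‖f x - κ‖ₑ ≤
          t * volume (cube (childCorner a ℓ v) (ℓ / 2))
      · exact ih (fun m hm => hD m (by omega)) _ _ hℓ2 (hsub.trans hQ) hv
      -- A stopped child: its average exceeds t, but is at most 2^d t because the parent was not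
      -- stopped.
      · obtain ⟨h₁, h₂, hm₁, hm₂, hle, hi⟩ := hD n (by omega) _ _ hℓ2 (hsub.trans hQ)
        refine ⟨_, subset_rfl, measurableSet_cube _ _, (not_le.1 hv).le, h₁, h₂, hm₁, hm₂,
          fun x hx => ?_, hi⟩
        have h3 : ‖(⨍ y in cube (childCorner a ℓ v) (ℓ / 2), f y) - κ‖ₑ ≤ 2 ^ d * t := by
          refine (enorm_setAverage_sub_le hf _ hℓ2 κ).trans ?_
          rw [mul_comm, ← div_eq_mul_inv]
          refine ENNReal.div_le_of_le_mul ?_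
          calc _ ≤ ∫⁻ x in cube a ℓ, ‖f x - κ‖ₑ := lintegral_mono_set hsub
            _ ≤ t * volume (cube a ℓ) := ht
            _ = _ := by rw [← volume_child a v]; ring
        calc _ ≤ ‖dyadicAverage f n (childCorner a ℓ v) (ℓ / 2) x -
                ⨍ y in cube (childCorner a ℓ v) (ℓ / 2), f y‖ₑ +
              ‖(⨍ y in cube (childCorner a ℓ v) (ℓ / 2), f y) - κ‖ₑ := by
              have h4 := enorm_add_le
                (dyadicAverage f n (childCorner a ℓ v) (ℓ / 2) x -
                  ⨍ y in cube (childCorner a ℓ v) (ℓ / 2), f y)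
                ((⨍ y in cube (childCorner a ℓ v) (ℓ / 2), f y) - κ)
              rwa [sub_add_sub_cancel] at h4
          _ ≤ (0 + h₁ x + h₂ x) + 2 ^ d * t := add_le_add (hle x hx) h3
          _ = _ := by ring
    choose E hEsub hEm hEt hE using hstep
    have hEd : Pairwise fun v v' => Disjoint (E v) (E v') := fun v v' hv =>
      (pairwise_disjoint_child a hℓ hv).mono (hEsub v) (hEsub v')
    refine ⟨⋃ v, E v, Set.iUnion_subset fun v => (hEsub v).trans (child_subset a hℓ v),
      MeasurableSet.iUnion hEm, ?_, HasMajorant.glue_children hB hℓ hEm hEsub fun v =>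
        (hE v).congr fun x hx => ?_⟩
    · rw [measure_iUnion hEd hEm, lintegral_iUnion hEm hEd, ← ENNReal.tsum_mul_left]
      exact ENNReal.tsum_le_tsum hEt
    · rw [dyadicAverage, (mem_child_iff (child_subset a hℓ v hx) v).1 hx]

/-- Minkowski in L^r(σ): the constant contributes 2^(d+1) K^(1/r) ε μ(P)^(1/r), and h contributes A
θ^(1/r) ε μ(P)^(1/r). The hypothesis on A makes the bound reproduce itself. -/
theorem lintegral_const_add_rpow_le {P E : Set (EuclideanSpace ℝ (Fin d))} (hr : 1 ≤ r)
    {K A θ ε V : ℝ≥0∞} (hV0 : V ≠ 0) (hVt : V ≠ ∞)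
    (hμσ : μ P ^ (r - 1) * σ P ≤ K * V ^ r) (hA : 2 ^ (d + 1) * K ^ (1 / r) + A * θ ^ (1 / r) ≤ A)
    (hE : μ E ≤ θ * μ P) {h : EuclideanSpace ℝ (Fin d) → ℝ≥0∞} (hm : Measurable h)
    (hi : ∫⁻ x in P, h x ^ r ∂σ ≤ (A * ε) ^ r * μ E) (hPt : μ P ≠ ∞) (hP0 : μ P ≠ 0) :
    ∫⁻ x in P, (2 ^ d * (2 * ε * μ P / V) + h x) ^ r ∂σ ≤ (A * ε) ^ r * μ P := by
  have hr0 : 0 < r := by linarith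
  have hr' : 0 ≤ 1 / r := by positivity
  have hpow : ∀ x : ℝ≥0∞, (x ^ r) ^ (1 / r) = x := fun x => by
    rw [← ENNReal.rpow_mul, mul_one_div_cancel hr0.ne', ENNReal.rpow_one]
  set c : ℝ≥0∞ := 2 ^ d * (2 * ε * μ P / V) with hc
  have h1 : c ^ r * σ P ≤ (2 ^ (d + 1) * ε) ^ r * K * μ P := by
    have e1 : c = 2 ^ (d + 1) * ε * (μ P * V⁻¹) := by rw [hc, pow_succ, div_eq_mul_inv]; ring
    calc c ^ r * σ P = (2 ^ (d + 1) * ε) ^ r * (V⁻¹) ^ r * (μ P ^ r * σ P) := by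
          rw [e1, ENNReal.mul_rpow_of_nonneg (_ * _) _ hr0.le,
            ENNReal.mul_rpow_of_nonneg (μ P) _ hr0.le]
          ring
      _ = (2 ^ (d + 1) * ε) ^ r * (V⁻¹) ^ r * (μ P ^ (r - 1) * σ P * μ P) := by
        congr 1
        nth_rewrite 1 [show r = r - 1 + 1 by ring]
        rw [ENNReal.rpow_add _ _ hP0 hPt, ENNReal.rpow_one]
        ring
      _ ≤ (2 ^ (d + 1) * ε) ^ r * (V⁻¹) ^ r * (K * V ^ r * μ P) := by gcongr
      _ = (2 ^ (d + 1) * ε) ^ r * K * μ P * (V⁻¹ * V) ^ r := by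
        rw [ENNReal.mul_rpow_of_nonneg V⁻¹ _ hr0.le]; ring
      _ = _ := by rw [ENNReal.inv_mul_cancel hV0 hVt, ENNReal.one_rpow, mul_one]
  have h2 : (∫⁻ x in P, (c + h x) ^ r ∂σ) ^ (1 / r) ≤ A * ε * μ P ^ (1 / r) := by
    calc _ ≤ (∫⁻ _ in P, c ^ r ∂σ) ^ (1 / r) + (∫⁻ x in P, h x ^ r ∂σ) ^ (1 / r) :=
          ENNReal.lintegral_Lp_add_le (f := fun _ => c) aemeasurable_const hm.aemeasurable hr
      _ ≤ ((2 ^ (d + 1) * ε) ^ r * K * μ P) ^ (1 / r) +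
          ((A * ε) ^ r * (θ * μ P)) ^ (1 / r) := by
        rw [setLIntegral_const]
        gcongr
        exact hi.trans (by gcongr)
      _ = (2 ^ (d + 1) * K ^ (1 / r) + A * θ ^ (1 / r)) * ε * μ P ^ (1 / r) := by
        rw [ENNReal.mul_rpow_of_nonneg _ (μ P) hr', ENNReal.mul_rpow_of_nonneg _ K hr',
          ENNReal.mul_rpow_of_nonneg _ (θ * μ P) hr', ENNReal.mul_rpow_of_nonneg θ _ hr', hpow, hpow]
        ring
      _ ≤ _ := by gcongr
  have h3 := ENNReal.rpow_le_rpow h2 hr0.le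
  rwa [ENNReal.mul_rpow_of_nonneg _ _ hr0.le, ← ENNReal.rpow_mul, ← ENNReal.rpow_mul,
    one_div_mul_cancel hr0.ne', ENNReal.rpow_one, ENNReal.rpow_one] at h3

/-- Chebyshev: the stopping level is twice the bound on the average, so the stopped set fills at
most half of the cube. -/
theorem two_mul_le_of_mul_le {ε m V s I : ℝ≥0∞} (hε0 : ε ≠ 0) (hεt : ε ≠ ∞) (hm0 : m ≠ 0)
    (hmt : m ≠ ∞) (hV0 : V ≠ 0) (hVt : V ≠ ∞) (h : 2 * ε * m / V * s ≤ I) (hI : I ≤ ε * m) :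
    2 * s ≤ V := by
  have h1 : ε * m * (2 * s) ≤ ε * m * V := by
    calc ε * m * (2 * s) = 2 * ε * m / V * s * V := by
          rw [mul_right_comm (2 * ε * m / V), ENNReal.div_mul_cancel hV0 hVt]; ring
      _ ≤ ε * m * V := mul_le_mul' (h.trans hI) le_rfl
  rwa [ENNReal.mul_le_mul_iff_right (mul_ne_zero hε0 hm0) (ENNReal.mul_ne_top hεt hmt)] at h1

/-- Strong induction on n, over all subcubes at once: inside a stopped cube fewer generations
remain. The constant created on a cube joins h₁ if the cube is good and h₂ if it is bad. -/
theorem hasMajorant_dyadicAverage (hf : LocallyIntegrable f volume) (hB : MeasurableSet B)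
    (hr : 1 ≤ r) {K A θ ε M : ℝ≥0∞}
    (hμ : ∀ a ℓ, 0 < ℓ → μ (cube a ℓ) ≠ 0 ∧ μ (cube a ℓ) ≠ ∞)
    (hμσ : ∀ a ℓ, 0 < ℓ → μ (cube a ℓ) ^ (r - 1) * σ (cube a ℓ) ≤ K * volume (cube a ℓ) ^ r)
    (hθ : ∀ a ℓ, 0 < ℓ → ∀ s, MeasurableSet s → s ⊆ cube a ℓ →
      2 * volume s ≤ volume (cube a ℓ) → μ s ≤ θ * μ (cube a ℓ))
    (hA : 2 ^ (d + 1) * K ^ (1 / r) + A * θ ^ (1 / r) ≤ A)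
    (hε0 : ε ≠ 0) (hεt : ε ≠ ∞) (hM0 : M ≠ 0) (hMt : M ≠ ∞)
    (hosc : ∀ a ℓ, 0 < ℓ → cube a ℓ ⊆ Q →
      ∫⁻ x in cube a ℓ, ‖f x - ⨍ y in cube a ℓ, f y‖ₑ ≤ ε * μ (cube a ℓ) ∨
      (cube a ℓ ⊆ B ∧ ∫⁻ x in cube a ℓ, ‖f x - ⨍ y in cube a ℓ, f y‖ₑ ≤ M * μ (cube a ℓ))) (n : ℕ) :
    ∀ a ℓ, 0 < ℓ → cube a ℓ ⊆ Q →
      HasMajorant μ σ r ((A * ε) ^ r) ((A * M) ^ r) B (cube a ℓ) (cube a ℓ) 0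
        fun x => ‖dyadicAverage f n a ℓ x - ⨍ y in cube a ℓ, f y‖ₑ := by
  have hr0 : 0 < r := by linarith
  induction n using Nat.strong_induction_on with
  | _ n ih =>
    intro a ℓ hℓ hQ
    have hV0 := volume_cube_pos a hℓ
    have hVt := volume_cube_ne_top a ℓ
    obtain ⟨hP0, hPt⟩ := hμ a ℓ hℓ
    have key : ∀ ρ : ℝ≥0∞, ρ ≠ 0 → ρ ≠ ∞ →
        ∫⁻ x in cube a ℓ, ‖f x - ⨍ y in cube a ℓ, f y‖ₑ ≤ ρ * μ (cube a ℓ) →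
        ∃ E ⊆ cube a ℓ, μ E ≤ θ * μ (cube a ℓ) ∧
          HasMajorant μ σ r ((A * ε) ^ r) ((A * M) ^ r) B (cube a ℓ) E
            (2 ^ d * (2 * ρ * μ (cube a ℓ) / volume (cube a ℓ)))
            fun x => ‖dyadicAverage f n a ℓ x - ⨍ y in cube a ℓ, f y‖ₑ := by
      intro ρ hρ0 hρt hρ
      obtain ⟨E, hEsub, hEm, hEt, hE⟩ := exists_stopping hf hB hr0 ih (⨍ y in cube a ℓ, f y)
        (2 * ρ * μ (cube a ℓ) / volume (cube a ℓ)) a ℓ hℓ hQ (by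
          rw [ENNReal.div_mul_cancel hV0 hVt, mul_assoc]
          exact hρ.trans (le_mul_of_one_le_left zero_le (by norm_num)))
      exact ⟨E, hEsub, hθ a ℓ hℓ E hEm hEsub (two_mul_le_of_mul_le hρ0 hρt hP0 hPt hV0 hVt hEt
        ((lintegral_mono_set hEsub).trans hρ)), hE⟩
    rcases hosc a ℓ hℓ hQ with hgood | ⟨hsubB, hbad⟩
    · obtain ⟨E, hEsub, hEθ, h₁, h₂, hm₁, hm₂, hle, hi₁, hi₂⟩ := key ε hε0 hεt hgood
      refine ⟨fun x => 2 ^ d * (2 * ε * μ (cube a ℓ) / volume (cube a ℓ)) + h₁ x, h₂,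
        hm₁.const_add _, hm₂, fun x hx => by simpa using hle x hx,
        lintegral_const_add_rpow_le hr hV0 hVt (hμσ a ℓ hℓ) hA hEθ hm₁ hi₁ hPt hP0,
        hi₂.trans (by gcongr)⟩
    · obtain ⟨E, hEsub, hEθ, h₁, h₂, hm₁, hm₂, hle, hi₁, hi₂⟩ := key M hM0 hMt hbad
      -- A bad cube lies in B, so E ∩ B = E and the gain θ is available for h₂ too.
      rw [Set.inter_eq_left.2 (hEsub.trans hsubB)] at hi₂
      refine ⟨h₁, fun x => 2 ^ d * (2 * M * μ (cube a ℓ) / volume (cube a ℓ)) + h₂ x,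
        hm₁, hm₂.const_add _, fun x hx => (hle x hx).trans (le_of_eq (by ring)),
        hi₁.trans (by gcongr), ?_⟩
      rw [Set.inter_eq_left.2 hsubB]
      exact lintegral_const_add_rpow_le hr hV0 hVt (hμσ a ℓ hℓ) hA hEθ hm₂ hi₂ hPt hP0

/-- The majorants have norms bounded uniformly in n, and the dyadic averages converge to f almost
everywhere, so Fatou applies. -/
theorem lintegral_rpow_sub_average_le (hf : LocallyIntegrable f volume)
    (hr : 1 ≤ r) (hσ : σ ≪ volume) {A ε M : ℝ≥0∞} {a : EuclideanSpace ℝ (Fin d)} {ℓ : ℝ}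
    (hℓ : 0 < ℓ)
    (hmaj : ∀ n, HasMajorant μ σ r ((A * ε) ^ r) ((A * M) ^ r) B (cube a ℓ) (cube a ℓ) 0
      fun x => ‖dyadicAverage f n a ℓ x - ⨍ y in cube a ℓ, f y‖ₑ) :
    (∫⁻ x in cube a ℓ, ‖f x - ⨍ y in cube a ℓ, f y‖ₑ ^ r ∂σ) ^ (1 / r) ≤
      A * (ε * μ (cube a ℓ) ^ (1 / r) + M * μ (cube a ℓ ∩ B) ^ (1 / r)) := by
  have hr0 : 0 < r := by linarith
  have hr' : 0 ≤ 1 / r := by positivity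
  have hpow : ∀ x : ℝ≥0∞, (x ^ r) ^ (1 / r) = x := fun x => by
    rw [← ENNReal.rpow_mul, mul_one_div_cancel hr0.ne', ENNReal.rpow_one]
  have hpow' : ∀ x : ℝ≥0∞, (x ^ (1 / r)) ^ r = x := fun x => by
    rw [← ENNReal.rpow_mul, one_div_mul_cancel hr0.ne', ENNReal.rpow_one]
  choose h₁ h₂ hm₁ hm₂ hle hi₁ hi₂ using hmaj
  set T := A * (ε * μ (cube a ℓ) ^ (1 / r) + M * μ (cube a ℓ ∩ B) ^ (1 / r))
  have hbound : ∀ n, ∫⁻ x in cube a ℓ, (h₁ n x + h₂ n x) ^ r ∂σ ≤ T ^ r := by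
    intro n
    rw [← hpow' (∫⁻ x in cube a ℓ, (h₁ n x + h₂ n x) ^ r ∂σ)]
    refine ENNReal.rpow_le_rpow ?_ hr0.le
    calc _ ≤ (∫⁻ x in cube a ℓ, h₁ n x ^ r ∂σ) ^ (1 / r) +
          (∫⁻ x in cube a ℓ, h₂ n x ^ r ∂σ) ^ (1 / r) :=
          ENNReal.lintegral_Lp_add_le (hm₁ n).aemeasurable (hm₂ n).aemeasurable hr
      _ ≤ ((A * ε) ^ r * μ (cube a ℓ)) ^ (1 / r) +
          ((A * M) ^ r * μ (cube a ℓ ∩ B)) ^ (1 / r) := by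
        gcongr
        exacts [hi₁ n, hi₂ n]
      _ = T := by
        rw [ENNReal.mul_rpow_of_nonneg _ _ hr', ENNReal.mul_rpow_of_nonneg _ _ hr', hpow, hpow]
        ring
  have hlim : ∀ᵐ x ∂σ.restrict (cube a ℓ), ‖f x - ⨍ y in cube a ℓ, f y‖ₑ ^ r ≤
      liminf (fun n => (h₁ n x + h₂ n x) ^ r) atTop := by
    filter_upwards [ae_restrict_of_ae (hσ.ae_le (tendsto_dyadicAverage hf a hℓ)),
      ae_restrict_mem (measurableSet_cube a ℓ)] with x hx hxa
    have h3 : Tendsto (fun n => ‖dyadicAverage f n a ℓ x - ⨍ y in cube a ℓ, f y‖ₑ ^ r) atTop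
        (𝓝 (‖f x - ⨍ y in cube a ℓ, f y‖ₑ ^ r)) :=
      (ENNReal.continuous_rpow_const.tendsto _).comp ((hx hxa).sub_const _).enorm
    rw [← h3.liminf_eq]
    refine liminf_le_liminf (Eventually.of_forall fun n => ?_)
    refine ENNReal.rpow_le_rpow ?_ hr0.le
    simpa using hle n x hxa
  rw [← hpow T]
  refine ENNReal.rpow_le_rpow ?_ hr'
  calc _ ≤ ∫⁻ x in cube a ℓ, liminf (fun n => (h₁ n x + h₂ n x) ^ r) atTop ∂σ :=
        lintegral_mono_ae hlim
    _ ≤ liminf (fun n => ∫⁻ x in cube a ℓ, (h₁ n x + h₂ n x) ^ r ∂σ) atTop :=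
        lintegral_liminf_le fun n => ((hm₁ n).add (hm₂ n)).pow_const r
    _ ≤ liminf (fun _ : ℕ => T ^ r) atTop :=
        liminf_le_liminf (Eventually.of_forall hbound)
    _ = T ^ r := by simp

end Majorant

/-! ### Weighted oscillations -/

section Oscillation

variable {d : ℕ} {w : EuclideanSpace ℝ (Fin d) → ℝ} {f : EuclideanSpace ℝ (Fin d) → ℂ}

theorem aemeasurable_enorm_sub_const (hf : LocallyIntegrable f volume) (κ : ℂ) :
    AEMeasurable (fun x => ‖f x - κ‖ₑ) volume :=
  (hf.aestronglyMeasurable.sub aestronglyMeasurable_const).enorm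

theorem lintegral_div_rpow_wMeasure (hw : IsWeight w) (hf : LocallyIntegrable f volume) {r : ℝ}
    (hr : 0 ≤ r) (κ : ℂ) (a : EuclideanSpace ℝ (Fin d)) (ℓ : ℝ) :
    ∫⁻ x in cube a ℓ, (‖f x - κ‖ₑ / ENNReal.ofReal (w x)) ^ r ∂(wMeasure w) =
      ∫⁻ x in cube a ℓ, ‖f x - κ‖ₑ ^ r
        ∂(volume.withDensity fun x => ENNReal.ofReal (w x) ^ (1 - r)) := by
  have hu := hw.aemeasurable_ofReal
  have hN := aemeasurable_enorm_sub_const hf κ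
  have hg : AEMeasurable (fun x => (‖f x - κ‖ₑ / ENNReal.ofReal (w x)) ^ r)
      (volume.restrict (cube a ℓ)) := ((hN.div hu).pow_const r).restrict
  rw [wMeasure, restrict_withDensity (measurableSet_cube a ℓ),
    restrict_withDensity (measurableSet_cube a ℓ),
    lintegral_withDensity_eq_lintegral_mul₀ hu.restrict hg,
    lintegral_withDensity_eq_lintegral_mul₀ (hu.pow_const _).restrict (hN.pow_const r).restrict]
  refine lintegral_congr_ae ?_
  filter_upwards [ae_restrict_of_ae hw.ae_ofReal_ne_zero] with x hx
  simp only [Pi.mul_apply, ENNReal.div_rpow_of_nonneg _ _ hr]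
  rw [ENNReal.rpow_sub _ _ hx ENNReal.ofReal_ne_top, ENNReal.rpow_one, div_eq_mul_inv,
    div_eq_mul_inv]
  ring

/-- For exponent 1 the weight cancels in the integrand and enters only through w(Q). -/
theorem osc_one_eq (hw : IsWeight w) (hf : LocallyIntegrable f volume) (α : ℝ)
    (a : EuclideanSpace ℝ (Fin d)) (ℓ : ℝ) :
    osc w 1 α f (cube a ℓ) = wMeasure w (cube a ℓ) ^ (-α / d) * ((wMeasure w (cube a ℓ))⁻¹ *
      ∫⁻ x in cube a ℓ, ‖f x - ⨍ y in cube a ℓ, f y‖ₑ) := by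
  rw [osc, lintegral_div_rpow_wMeasure hw hf zero_le_one]
  simp

theorem osc_one_le (hw : IsWeight w) (hf : LocallyIntegrable f volume) {r : ℝ} (hr : 1 ≤ r)
    (α : ℝ) (a : EuclideanSpace ℝ (Fin d)) {ℓ : ℝ} (hℓ : 0 < ℓ) :
    osc w 1 α f (cube a ℓ) ≤ osc w r α f (cube a ℓ) := by
  have hr0 : 0 < r := by linarith
  have hW0 := hw.wMeasure_cube_ne_zero a hℓ
  have hWt := hw.wMeasure_cube_ne_top a ℓ
  rw [osc, osc]
  gcongr
  simp only [ENNReal.rpow_one, div_one]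
  set g := fun x => ‖f x - ⨍ y in cube a ℓ, f y‖ₑ / ENNReal.ofReal (w x)
  have hg : AEMeasurable g ((wMeasure w).restrict (cube a ℓ)) :=
    (((aemeasurable_enorm_sub_const hf _).div hw.aemeasurable_ofReal).mono_ac
      wMeasure_absolutelyContinuous).restrict
  have h := lintegral_rpow_le_rpow_lintegral (hg.pow_const r) (s := 1 / r) (by positivity)
    (by rw [div_le_one hr0]; exact hr)
  simp only [← ENNReal.rpow_mul, mul_one_div_cancel hr0.ne', ENNReal.rpow_one,
    Measure.restrict_apply_univ] at h
  calc _ ≤ (wMeasure w (cube a ℓ))⁻¹ * ((∫⁻ x in cube a ℓ, g x ^ r ∂(wMeasure w)) ^ (1 / r) *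
        wMeasure w (cube a ℓ) ^ (1 - 1 / r)) := by gcongr
    _ = (wMeasure w (cube a ℓ) ^ (-1 : ℝ) * wMeasure w (cube a ℓ) ^ (1 - 1 / r)) *
        (∫⁻ x in cube a ℓ, g x ^ r ∂(wMeasure w)) ^ (1 / r) := by
        rw [ENNReal.rpow_neg_one]; ring
    _ = _ := by
      rw [ENNReal.mul_rpow_of_nonneg _ _ (by positivity : 0 ≤ 1 / r), ← ENNReal.rpow_add _ _ hW0 hWt,
        ENNReal.inv_rpow, ← ENNReal.rpow_neg]
      congr 2
      ring

theorem osc_one_le_iff (hw : IsWeight w) (hf : LocallyIntegrable f volume) (α : ℝ)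
    (a : EuclideanSpace ℝ (Fin d)) {ℓ : ℝ} (hℓ : 0 < ℓ) {ε : ℝ≥0∞} :
    osc w 1 α f (cube a ℓ) ≤ ε ↔ ∫⁻ x in cube a ℓ, ‖f x - ⨍ y in cube a ℓ, f y‖ₑ ≤
      ε * wMeasure w (cube a ℓ) ^ (α / d) * wMeasure w (cube a ℓ) := by
  have hW0 := hw.wMeasure_cube_ne_zero a hℓ
  have hWt := hw.wMeasure_cube_ne_top a ℓ
  have hp0 : wMeasure w (cube a ℓ) ^ (α / d) ≠ 0 := (ENNReal.rpow_pos (pos_iff_ne_zero.2 hW0) hWt).ne'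
  have hpt : wMeasure w (cube a ℓ) ^ (α / d) ≠ ∞ := ENNReal.rpow_ne_top_of_ne_zero hW0 hWt
  rw [osc_one_eq hw hf, neg_div, ENNReal.rpow_neg, ← mul_assoc, mul_comm, ← mul_assoc,
    ← div_eq_mul_inv, ← div_eq_mul_inv, ENNReal.div_le_iff hW0 hWt, ENNReal.div_le_iff hp0 hpt,
    mul_right_comm]

/-- The factor 2 pays for replacing the average over the small cube by that over the large one; the
powers of D compare the two normalisations. -/
theorem osc_one_le_of_subset (hw : IsWeight w) (hf : LocallyIntegrable f volume) {α : ℝ}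
    (hα : 0 ≤ α) {a b : EuclideanSpace ℝ (Fin d)} {ℓ s : ℝ} (hℓ : 0 < ℓ) (hs : 0 < s)
    (hsub : cube b s ⊆ cube a ℓ) {D : ℝ≥0∞}
    (hD : wMeasure w (cube a ℓ) ≤ D * wMeasure w (cube b s)) :
    osc w 1 α f (cube b s) ≤ 2 * D ^ (α / d) * D * osc w 1 α f (cube a ℓ) := by
  have hα' : 0 ≤ α / d := by positivity
  rw [osc_one_le_iff hw hf α b hs]
  have h := (osc_one_le_iff hw hf α a hℓ).1 le_rfl
  set κ := ⨍ y in cube a ℓ, f y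
  set ω := osc w 1 α f (cube a ℓ)
  have h1 : ∫⁻ x in cube b s, ‖f x - ⨍ y in cube b s, f y‖ₑ ≤
      2 * ∫⁻ x in cube b s, ‖f x - κ‖ₑ := by
    calc _ ≤ ∫⁻ x in cube b s, (‖f x - κ‖ₑ + ‖(⨍ y in cube b s, f y) - κ‖ₑ) := by
          refine lintegral_mono fun x => ?_
          have h2 := enorm_sub_le (a := f x - κ) (b := (⨍ y in cube b s, f y) - κ)
          rwa [sub_sub_sub_cancel_right] at h2
      _ = (∫⁻ x in cube b s, ‖f x - κ‖ₑ) +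
          ‖(⨍ y in cube b s, f y) - κ‖ₑ * volume (cube b s) := by
        rw [lintegral_add_right _ measurable_const, setLIntegral_const]
      _ ≤ (∫⁻ x in cube b s, ‖f x - κ‖ₑ) +
          (volume (cube b s))⁻¹ * (∫⁻ x in cube b s, ‖f x - κ‖ₑ) * volume (cube b s) := by
        gcongr
        exact enorm_setAverage_sub_le hf b hs κ
      _ = _ := by
        rw [mul_right_comm, ENNReal.inv_mul_cancel (volume_cube_pos b hs) (volume_cube_ne_top b s),
          one_mul, two_mul]
  calc _ ≤ 2 * ∫⁻ x in cube b s, ‖f x - κ‖ₑ := h1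
    _ ≤ 2 * ∫⁻ x in cube a ℓ, ‖f x - κ‖ₑ := by gcongr
    _ ≤ 2 * (ω * wMeasure w (cube a ℓ) ^ (α / d) * wMeasure w (cube a ℓ)) := by gcongr
    _ ≤ 2 * (ω * (D * wMeasure w (cube b s)) ^ (α / d) * (D * wMeasure w (cube b s))) := by gcongr
    _ = _ := by rw [ENNReal.mul_rpow_of_nonneg _ _ hα']; ring

theorem DualApBound.exists_osc_le {r : ℝ} {K : ℝ≥0∞} (hK : DualApBound w r K) (hKt : K ≠ ∞)
    (hw : IsWeight w) (hr : 1 < r) :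
    ∃ A : ℝ≥0∞, A ≠ ∞ ∧ ∀ (α : ℝ), 0 ≤ α → ∀ f : EuclideanSpace ℝ (Fin d) → ℂ,
      LocallyIntegrable f volume → ∀ B : Set (EuclideanSpace ℝ (Fin d)), MeasurableSet B →
      ∀ ε M : ℝ≥0∞, ε ≠ 0 → ε ≠ ∞ → M ≠ 0 → M ≠ ∞ →
      ∀ (a : EuclideanSpace ℝ (Fin d)) (ℓ : ℝ), 0 < ℓ →
      (∀ b s, 0 < s → cube b s ⊆ cube a ℓ →
        osc w 1 α f (cube b s) ≤ ε ∨ (cube b s ⊆ B ∧ osc w 1 α f (cube b s) ≤ M)) →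
      osc w r α f (cube a ℓ) ≤
        A * (ε + M * (wMeasure w (cube a ℓ ∩ B) / wMeasure w (cube a ℓ)) ^ (1 / r)) := by
  obtain ⟨θ, hθ1, hθ⟩ := hK.exists_wMeasure_le_of_half hKt hw hr
  have hr0 : 0 < r := by linarith
  have hr' : 0 < 1 / r := by positivity
  have hθ' : θ ^ (1 / r) < 1 := ENNReal.rpow_lt_one hθ1 hr'
  have hsub0 : 1 - θ ^ (1 / r) ≠ 0 := (tsub_pos_of_lt hθ').ne'
  have hsubt : 1 - θ ^ (1 / r) ≠ ∞ := by simp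
  -- The sum of the geometric series with ratio θ^(1/r), i.e. the fixed point of A ↦ 2^(d+1) K^(1/r)
  -- + A θ^(1/r).
  set A : ℝ≥0∞ := 2 ^ (d + 1) * K ^ (1 / r) * (1 - θ ^ (1 / r))⁻¹ with hAdef
  have hA : 2 ^ (d + 1) * K ^ (1 / r) + A * θ ^ (1 / r) ≤ A := by
    have h1 : 2 ^ (d + 1) * K ^ (1 / r) = A * (1 - θ ^ (1 / r)) := by
      rw [hAdef, mul_assoc, ENNReal.inv_mul_cancel hsub0 hsubt, mul_one]
    rw [h1, ← mul_add, tsub_add_cancel_of_le hθ'.le, mul_one]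
  refine ⟨A, ENNReal.mul_ne_top (ENNReal.mul_ne_top (by simp)
    (ENNReal.rpow_ne_top_of_nonneg hr'.le hKt)) (ENNReal.inv_ne_top.2 hsub0), ?_⟩
  intro α hα f hf B hB ε M hε0 hεt hM0 hMt a ℓ hℓ hosc
  have hα' : 0 ≤ α / d := by positivity
  have hW0 := hw.wMeasure_cube_ne_zero a hℓ
  have hWt := hw.wMeasure_cube_ne_top a ℓ
  set W := wMeasure w (cube a ℓ) with hW
  set c := W ^ (α / d) with hc
  have hc0 : c ≠ 0 := (ENNReal.rpow_pos (pos_iff_ne_zero.2 hW0) hWt).ne'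
  have hct : c ≠ ∞ := ENNReal.rpow_ne_top_of_ne_zero hW0 hWt
  set σ := volume.withDensity fun x => ENNReal.ofReal (w x) ^ (1 - r) with hσ
  have hmaj := hasMajorant_dyadicAverage (μ := wMeasure w) (σ := σ) (K := K) (A := A) (θ := θ)
    (ε := ε * c) (M := M * c) (Q := cube a ℓ) hf hB hr.le
    (fun a ℓ hℓ => ⟨hw.wMeasure_cube_ne_zero a hℓ, hw.wMeasure_cube_ne_top a ℓ⟩)
    (fun a ℓ hℓ => by
      rw [hσ, withDensity_apply _ (measurableSet_cube a ℓ)]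
      exact hK a ℓ hℓ) hθ hA
    (mul_ne_zero hε0 hc0) (ENNReal.mul_ne_top hεt hct) (mul_ne_zero hM0 hc0)
    (ENNReal.mul_ne_top hMt hct) (by
      intro b s hs hsub
      -- As α ≥ 0, the fractional factor of any subcube is at most that of the top cube, so it can
      -- be frozen there and absorbed into ε and M.
      have hle : wMeasure w (cube b s) ^ (α / d) ≤ c := by rw [hc, hW]; gcongr
      refine (hosc b s hs hsub).imp (fun h => ?_) (fun h => ⟨h.1, ?_⟩)
      · exact ((osc_one_le_iff hw hf α b hs).1 h).trans (by gcongr)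
      · exact ((osc_one_le_iff hw hf α b hs).1 h.2).trans (by gcongr))
  have h := lintegral_rpow_sub_average_le hf hr.le (withDensity_absolutelyContinuous _ _) hℓ
    fun n => hmaj n a ℓ hℓ subset_rfl
  rw [osc, lintegral_div_rpow_wMeasure hw hf hr0.le, ENNReal.mul_rpow_of_nonneg _ _ hr'.le,
    neg_div, ENNReal.rpow_neg, ← hW, ← hc, ENNReal.div_rpow_of_nonneg _ _ hr'.le]
  set Z := wMeasure w (cube a ℓ ∩ B) ^ (1 / r)
  have hWr0 : W ^ (1 / r) ≠ 0 := (ENNReal.rpow_pos (pos_iff_ne_zero.2 hW0) hWt).ne'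
  have hWrt : W ^ (1 / r) ≠ ∞ := ENNReal.rpow_ne_top_of_ne_zero hW0 hWt
  calc _ ≤ c⁻¹ * (W⁻¹ ^ (1 / r) * (A * (ε * c * W ^ (1 / r) + M * c * Z))) := by gcongr
    _ = (c⁻¹ * c) * (A * (ε * ((W ^ (1 / r))⁻¹ * W ^ (1 / r)) + M * (Z * (W ^ (1 / r))⁻¹))) := by
      rw [ENNReal.inv_rpow]; ring
    _ = _ := by
      rw [ENNReal.inv_mul_cancel hc0 hct, ENNReal.inv_mul_cancel hWr0 hWrt, one_mul, mul_one,
        ← div_eq_mul_inv]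

/-! ### Passage to VMO -/

theorem side_le_of_cube_subset (hd : 1 ≤ d) {a b : EuclideanSpace ℝ (Fin d)} {ℓ s : ℝ}
    (hs : 0 < s) (h : cube b s ⊆ cube a ℓ) : s ≤ ℓ := by
  have h1 := measure_mono (μ := volume) h
  rw [volume_cube, volume_cube] at h1
  by_contra! hlt
  exact h1.not_gt (ENNReal.pow_lt_pow_left (by omega) ((ENNReal.ofReal_lt_ofReal_iff hs).2 hlt))

theorem VMO_subset_of_osc_le {r₁ r₂ α : ℝ}
    (h : ∀ f : EuclideanSpace ℝ (Fin d) → ℂ, LocallyIntegrable f volume → ∀ a ℓ, 0 < ℓ →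
      osc w r₁ α f (cube a ℓ) ≤ osc w r₂ α f (cube a ℓ)) :
    VMO w r₂ α ⊆ VMO w r₁ α := by
  rintro f ⟨⟨hf, hbmo⟩, hsmall, hlarge, htrans⟩
  refine ⟨⟨hf, lt_of_le_of_lt ?_ hbmo⟩, ?_, ?_, fun a ℓ hℓ => ?_⟩
  · exact iSup_mono fun a => iSup_mono fun ℓ => iSup_mono fun hℓ => h f hf a ℓ hℓ
  · exact tendsto_of_tendsto_of_tendsto_of_le_of_le tendsto_const_nhds hsmall (fun _ => zero_le)
      fun t => iSup_mono fun a => iSup_mono fun ℓ => iSup_mono fun hℓ => iSup_mono fun _ =>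
        h f hf a ℓ hℓ
  · exact tendsto_of_tendsto_of_tendsto_of_le_of_le tendsto_const_nhds hlarge (fun _ => zero_le)
      fun t => iSup_mono fun a => iSup_mono fun ℓ => iSup_mono fun hℓ => iSup_mono fun _ =>
        h f hf a ℓ hℓ
  · exact tendsto_of_tendsto_of_tendsto_of_le_of_le tendsto_const_nhds (htrans a ℓ hℓ)
      (fun _ => zero_le) fun x => h f hf _ ℓ hℓ

/-- For `f ∈ VMO` the oscillation is small on all cubes that are small, large or far away. -/
theorem exists_osc_one_le_of_mem_VMO {r : ℝ} {K : ℝ≥0∞} (hK : DualApBound w r K) (hKt : K ≠ ∞)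
    (hw : IsWeight w) (hr : 1 < r) {α : ℝ} (hα : 0 ≤ α) (hf : f ∈ VMO w 1 α) {ε : ℝ≥0∞}
    (hε : ε ≠ 0) :
    ∃ t T R : ℝ, 0 < t ∧ 0 < T ∧ 0 < R ∧ ∀ b s, 0 < s → (s ≤ t ∨ T ≤ s ∨ R ≤ ‖b‖) →
      osc w 1 α f (cube b s) ≤ ε := by
  obtain ⟨⟨hfl, -⟩, hsmall, hlarge, htrans⟩ := hf
  have hε' : 0 < ε := pos_iff_ne_zero.2 hε
  obtain ⟨t, ht, ht0⟩ := ((hsmall.eventually_le_const hε').and self_mem_nhdsWithin).exists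
  obtain ⟨T, hT, hTt⟩ := ((hlarge.eventually_le_const hε').and (eventually_ge_atTop t)).exists
  simp only [iSup_le_iff] at ht hT
  have ht0 : 0 < t := ht0
  have hT0 : 0 < T := ht0.trans_le hTt
  -- The translation condition gives no uniformity in the side. It is used only for side T; cubes of
  -- side between t and T are compared by doubling with the cube of side T at the same corner.
  obtain ⟨C, hCt, hC⟩ := hK.exists_doubling hKt hw hr (T / t)
  have hD : 2 * C ^ (α / d) * C ≠ ∞ := ENNReal.mul_ne_top (ENNReal.mul_ne_top (by simp)
    (ENNReal.rpow_ne_top_of_nonneg (by positivity) hCt)) hCt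
  have hlim : Tendsto (fun x => 2 * C ^ (α / d) * C * osc w 1 α f (cube (0 + x) T))
      (Bornology.cobounded (EuclideanSpace ℝ (Fin d))) (𝓝 0) := by
    simpa using ENNReal.Tendsto.const_mul (htrans 0 T hT0) (Or.inr hD)
  obtain ⟨R, -, hR⟩ := hasBasis_cobounded_norm.eventually_iff.1 (hlim.eventually_le_const hε')
  refine ⟨t, T, max R 1, ht0, hT0, by positivity, fun b s hs h => ?_⟩
  have hsmall' : s ≤ t → osc w 1 α f (cube b s) ≤ ε := ht b s hs
  have hlarge' : T ≤ s → osc w 1 α f (cube b s) ≤ ε := hT b s hs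
  rcases h with h | h | h
  · exact hsmall' h
  · exact hlarge' h
  · rcases le_total s t with hst | hst
    · exact hsmall' hst
    rcases le_total T s with hsT | hsT
    · exact hlarge' hsT
    have hsub : cube b s ⊆ cube b T := cube_subset_cube fun i => ⟨le_rfl, by linarith⟩
    have hTs : T ≤ T / t * s := by
      rw [div_mul_eq_mul_div, le_div_iff₀ ht0]
      gcongr
    refine (osc_one_le_of_subset hw hfl hα hT0 hs hsub (hC _ _ _ _ hT0 hs hTs hsub)).trans ?_
    have h5 := hR (show b ∈ {x | R ≤ ‖x‖} from (le_max_left _ _).trans h)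
    rwa [zero_add] at h5

theorem exists_mul_add_le {A η : ℝ≥0∞} (hA : A ≠ ∞) (hη : η ≠ 0) :
    ∃ ε : ℝ≥0∞, ε ≠ 0 ∧ ε ≠ ∞ ∧ A * (ε + ε) ≤ η := by
  have h1 : (A + 1) * 2 ≠ 0 := by simp
  have h2 : (A + 1) * 2 ≠ ∞ := ENNReal.mul_ne_top (by simpa using hA) (by simp)
  refine ⟨min 1 (η / ((A + 1) * 2)), ?_, by simp, ?_⟩
  · rw [← pos_iff_ne_zero, lt_min_iff]
    exact ⟨zero_lt_one, ENNReal.div_pos hη h2⟩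
  · calc _ ≤ (A + 1) * (η / ((A + 1) * 2) + η / ((A + 1) * 2)) := by
          gcongr
          exacts [le_self_add, min_le_right _ _, min_le_right _ _]
      _ = η / ((A + 1) * 2) * ((A + 1) * 2) := by ring
      _ ≤ η := (ENNReal.div_mul_cancel h1 h2).le

theorem subset_cube_of_norm_le {b : EuclideanSpace ℝ (Fin d)} {s T R : ℝ} (hs : s ≤ T)
    (hb : ‖b‖ ≤ R) : cube b s ⊆ cube (WithLp.toLp 2 fun _ => -R) (2 * R + T) := by
  refine cube_subset_cube fun i => ?_
  have h1 := abs_le.1 ((PiLp.norm_apply_le b i).trans hb)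
  simp only
  constructor <;> linarith

theorem eventually_disjoint_translate (a b : EuclideanSpace ℝ (Fin d)) (ℓ s : ℝ) :
    ∀ᶠ x in Bornology.cobounded (EuclideanSpace ℝ (Fin d)),
      cube (a + x) ℓ ∩ cube b s = ∅ := by
  obtain ⟨R₁, hR₁⟩ := (isBounded_cube a ℓ).exists_norm_le
  obtain ⟨R₂, hR₂⟩ := (isBounded_cube b s).exists_norm_le
  filter_upwards [eventually_cobounded_le_norm (R₁ + R₂ + 1)] with x hx
  refine Set.eq_empty_of_forall_notMem fun y ⟨hy₁, hy₂⟩ => ?_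
  have h1 : y - x ∈ cube a ℓ := fun i => by
    have := hy₁ i
    simp only [PiLp.add_apply, PiLp.sub_apply] at this ⊢
    constructor <;> linarith
  have h2 := norm_sub_le y (y - x)
  rw [sub_sub_cancel] at h2
  linarith [hR₁ _ h1, hR₂ _ hy₂]

theorem VMO_one_subset (hd : 1 ≤ d) {r : ℝ} {K : ℝ≥0∞} (hK : DualApBound w r K) (hKt : K ≠ ∞)
    (hw : IsWeight w) (hr : 1 < r) {α : ℝ} (hα : 0 ≤ α) : VMO w 1 α ⊆ VMO w r α := by
  intro f hf
  have hr' : 0 < 1 / r := by positivity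
  obtain ⟨A, hAt, hA⟩ := hK.exists_osc_le hKt hw hr
  have hfl : LocallyIntegrable f volume := hf.1.1
  set M := bmoNorm w 1 α f + 1 with hM
  have hM0 : M ≠ 0 := by simp [hM]
  have hMt : M ≠ ∞ := ENNReal.add_ne_top.2 ⟨hf.1.2.ne, by simp⟩
  have hbmo : ∀ b s, 0 < s → osc w 1 α f (cube b s) ≤ M := by
    have h : bmoNorm w 1 α f ≤ M := le_self_add
    simpa only [bmoNorm, iSup_le_iff] using h
  -- B = ∅: no bad cubes at all.
  have hempty : ∀ ε : ℝ≥0∞, ε ≠ 0 → ε ≠ ∞ → ∀ a ℓ, 0 < ℓ →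
      (∀ b s, 0 < s → cube b s ⊆ cube a ℓ → osc w 1 α f (cube b s) ≤ ε) →
      osc w r α f (cube a ℓ) ≤ A * ε := fun ε hε0 hεt a ℓ hℓ h => by
    have := hA α hα f hfl ∅ MeasurableSet.empty ε M hε0 hεt hM0 hMt a ℓ hℓ
      fun b s hs hsub => Or.inl (h b s hs hsub)
    simpa [ENNReal.zero_rpow_of_pos hr', -one_div] using this
  have hscale : ∀ ε : ℝ≥0∞, ε ≠ 0 → ε ≠ ∞ → ∃ t : ℝ, 0 < t ∧
      (∀ b s, 0 < s → s ≤ t → osc w 1 α f (cube b s) ≤ ε) ∧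
      ∃ (b₀ : EuclideanSpace ℝ (Fin d)) (s₀ : ℝ), 0 < s₀ ∧ ∀ a ℓ, 0 < ℓ → osc w r α f (cube a ℓ) ≤
        A * (ε + M * (wMeasure w (cube a ℓ ∩ cube b₀ s₀) / wMeasure w (cube a ℓ)) ^ (1 / r)) := by
    intro ε hε0 hεt
    obtain ⟨t, T, R, ht, hT, hR, h⟩ := exists_osc_one_le_of_mem_VMO hK hKt hw hr hα hf hε0
    refine ⟨t, ht, fun b s hs hst => h b s hs (Or.inl hst), _, 2 * R + T, by positivity,
      fun a ℓ hℓ => hA α hα f hfl _ (measurableSet_cube (WithLp.toLp 2 fun _ => -R) _) ε M hε0 hεt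
        hM0 hMt a ℓ hℓ fun b s hs _ => ?_⟩
    rcases le_total T s with hTs | hTs
    · exact Or.inl (h b s hs (Or.inr (Or.inl hTs)))
    rcases le_total R ‖b‖ with hRb | hRb
    · exact Or.inl (h b s hs (Or.inr (Or.inr hRb)))
    · exact Or.inr ⟨subset_cube_of_norm_le hTs hRb, hbmo b s hs⟩
  refine ⟨⟨hfl, ?_⟩, ?_, ?_, fun a ℓ hℓ => ?_⟩
  · refine lt_of_le_of_lt ?_ (ENNReal.mul_ne_top hAt hMt).lt_top
    exact iSup_le fun a => iSup_le fun ℓ => iSup_le fun hℓ => hempty M hM0 hMt a ℓ hℓ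
      fun b s hs _ => hbmo b s hs
  · rw [ENNReal.tendsto_nhds_zero]
    intro η hη
    obtain ⟨ε, hε0, hεt, hε⟩ := exists_mul_add_le hAt hη.ne'
    obtain ⟨t, ht, hsmall, -⟩ := hscale ε hε0 hεt
    filter_upwards [Ioc_mem_nhdsGT ht] with t' ht'
    refine iSup_le fun a => iSup_le fun ℓ => iSup_le fun hℓ => iSup_le fun hℓt => ?_
    refine (hempty ε hε0 hεt a ℓ hℓ fun b s hs hsub => hsmall b s hs ?_).trans
      (le_trans (by gcongr; exact le_self_add) hε)
    exact (side_le_of_cube_subset hd hs hsub).trans (hℓt.trans ht'.2)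
  · rw [ENNReal.tendsto_nhds_zero]
    intro η hη
    obtain ⟨ε, hε0, hεt, hε⟩ := exists_mul_add_le hAt hη.ne'
    obtain ⟨-, -, -, b₀, s₀, hs₀, hosc⟩ := hscale ε hε0 hεt
    -- The weight ratio (ε/M)^r turns M · ratio^(1/r) into ε.
    have hρ : (ε / M) ^ r ≠ 0 := (ENNReal.rpow_pos (ENNReal.div_pos hε0 hMt)
      (ENNReal.div_ne_top hεt hM0)).ne'
    obtain ⟨T, hT⟩ := hK.wMeasure_cube_le_mul_large hKt hw hr hd b₀ hs₀ hρ
    filter_upwards [eventually_ge_atTop T] with t' ht'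
    refine iSup_le fun a => iSup_le fun ℓ => iSup_le fun hℓ => iSup_le fun hℓt => ?_
    refine (hosc a ℓ hℓ).trans (le_trans ?_ hε)
    gcongr
    have hratio : wMeasure w (cube a ℓ ∩ cube b₀ s₀) / wMeasure w (cube a ℓ) ≤ (ε / M) ^ r := by
      refine ENNReal.div_le_of_le_mul ?_
      rcases (cube a ℓ ∩ cube b₀ s₀).eq_empty_or_nonempty with h | h
      · simp [h]
      · exact (measure_mono Set.inter_subset_right).trans (hT a ℓ (ht'.trans hℓt) h)
    calc _ ≤ M * ((ε / M) ^ r) ^ (1 / r) := by gcongr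
      _ = M * (ε / M) := by
        rw [← ENNReal.rpow_mul, mul_one_div_cancel (by linarith), ENNReal.rpow_one]
      _ ≤ ε := ENNReal.mul_div_le
  · rw [ENNReal.tendsto_nhds_zero]
    intro η hη
    obtain ⟨ε, hε0, hεt, hε⟩ := exists_mul_add_le hAt hη.ne'
    obtain ⟨-, -, -, b₀, s₀, -, hosc⟩ := hscale ε hε0 hεt
    filter_upwards [eventually_disjoint_translate a b₀ ℓ s₀] with x hx
    refine (hosc (a + x) ℓ hℓ).trans (le_trans ?_ hε)
    rw [hx]
    gcongr
    simp [ENNReal.zero_rpow_of_pos hr', -one_div]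

end Oscillation

end FracVMO

theorem theoremA2 (d : ℕ) (hd : 1 ≤ d) (p : ℝ) (hp : 1 ≤ p)
    (w : EuclideanSpace ℝ (Fin d) → ℝ) (hw : FracVMO.MemAp p w)
    (α : ℝ) (hα : 0 ≤ α)
    (r : ℝ) (hr : 1 ≤ r) (hrp : ENNReal.ofReal r ≤ ENNReal.conjExponent (ENNReal.ofReal p)) :
    FracVMO.VMO w r α = FracVMO.VMO w 1 α := by
  rcases hr.eq_or_lt with rfl | hr1
  · rfl
  obtain ⟨K, hKt, hK⟩ := hw.exists_dualApBound hp hr1 hrp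
  exact subset_antisymm
    (FracVMO.VMO_subset_of_osc_le fun f hf a ℓ hℓ => FracVMO.osc_one_le hw.1 hf hr α a hℓ)
    (FracVMO.VMO_one_subset hd hK hKt hw.1 hr1 hα)
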